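/- Let $N\ge 2$, let $\Omega\subset\mathbb R^N$ be a bounded connected open set with Lipschitz boundary, let $0<\alpha\le\beta<\infty$ and $c>0$, let $A^\ast\in L^2(\Omega;\mathbb S^N_{skew})$ be a nonzero skew-symmetric matrix field, and let $Q\subset L^2(\Omega;\mathbb S^N_{skew})$ be a convex compact set containing the zero field. For $A\in L^2(\Omega;\mathbb R^{N\times N})$ write $A^{sym}=\frac12(A+A^t)$, $A^{skew}=\frac12(A-A^t)$. A control $A\in L^2(\Omega;\mathbb R^{N\times N})$ is admissible if: every entry of $A^{sym}$ has total variation $\sup\{\int_\Omega a^{sym}_{ij}\,\mathrm{div}\,\Phi\,dx:\Phi\in C^1_c(\Omega;\mathbb R^N),\,|\Phi|\le1\}\le c$; $A^{sym}\in L^\infty$ and $\alpha I\le A^{sym}(x)\le\beta I$ for a.e. $x\in\Omega$ in the sense of quadratic forms; $|a^{skew}_{ij}(x)|\le|a^\ast_{ij}(x)|$ for a.e. $x\in\Omega$ and all $i<j$; and $A^{skew}\in Q$. Let $D(A)$ be the set of $y\in H^1_0(\Omega)$ for which there is a constant $k$ with $\left|\int_\Omega(\nabla\varphi,A^{skew}\nabla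 y)\,dx\right|\le k\,\|\nabla\varphi\|_{L^2(\Omega)}$ for all $\varphi\in C_c^\infty(\Omega)$; for $y\in D(A)$ let $[y,\cdot]_A$ be the extension by continuity to $H^1_0(\Omega)$ of $\varphi\mapsto\int_\Omega(\nabla\varphi,A^{skew}\nabla y)\,dx$. Given $f\in H^{-1}(\Omega)$, let $\Xi$ be the set of admissible pairs $(A,y)$, that is, $A$ is an admissible control, $y\in D(A)$, and $$\int_\Omega(\nabla\varphi,A^{sym}\nabla y)\,dx+[y,\varphi]_A=\langle f,\varphi\rangle\qquad\text{for all }\varphi\in H^1_0(\Omega)$$ (the weak form of $-\mathrm{div}(A\nabla y)=f$ in $\Omega$, $y=0$ on $\partial\Omega$). Then for every $f\in H^{-1}(\Omega)$ and $y_d\in L^2(\Omega)$ for which $\Xi\neq\emptyset$, the functional $$I(A,y)=\|y-y_d\|^2_{L^2(\Omega)}+\int_\Omega(\nabla y,A^{sym}\nabla y)\,dx$$ attains its infimum over $\Xi$: there is $(A^0,y^0)\in\Xi$ with $I(A^0,y^0)=\inf_{(A,y)\in\Xi}I(A,y)$. -/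

import Mathlib

open MeasureTheory TopologicalSpace Filter Topology
open scoped Distributions Matrix NNReal ENNReal

-- Matrices carry the norm `max |a i j|`; this is the norm used for `L²(Ω; 𝕄^N)` below.
attribute [local instance] Matrix.normedAddCommGroup Matrix.normedSpace

namespace OCP

noncomputable section

/-- The Euclidean space `ℝ^N`. -/
abbrev E (N : ℕ) : Type := EuclideanSpace ℝ (Fin N)

/-- The space `𝕄^N` of real `N × N` matrices. -/
abbrev Mat (N : ℕ) : Type := Matrix (Fin N) (Fin N) ℝ

/-- Lebesgue measure on the open set `Ω`. -/
abbrev leb {N : ℕ} (Ω : Opens (E N)) : Measure (E N) := volume.restrict (Ω : Set (E N))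

/-- `L²(Ω)`. -/
abbrev L2 {N : ℕ} (Ω : Opens (E N)) : Type := Lp ℝ 2 (leb Ω)

/-- `L²(Ω; ℝ^N)`. -/
abbrev L2Vec {N : ℕ} (Ω : Opens (E N)) : Type := Lp (E N) 2 (leb Ω)

/-- `L²(Ω; 𝕄^N)`. -/
abbrev L2Mat {N : ℕ} (Ω : Opens (E N)) : Type := Lp (Mat N) 2 (leb Ω)

/-- `Ω` has a Lipschitz boundary: near each boundary point, and for a suitable unit vector `e`,
the set `Ω` is the strict epigraph, in direction `e`, of a Lipschitz function on the hyperplane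
orthogonal to `e`. -/
def HasLipschitzBoundary {N : ℕ} (Ω : Set (E N)) : Prop :=
  ∀ x₀ ∈ frontier Ω, ∃ r : ℝ, 0 < r ∧ ∃ e : E N, ‖e‖ = 1 ∧
    ∃ (K : ℝ≥0) (g : (ℝ ∙ e)ᗮ → ℝ), LipschitzWith K g ∧
      ∀ x ∈ Metric.ball x₀ r, x ∈ Ω ↔ g ((ℝ ∙ e)ᗮ.orthogonalProjectionOnto x) < inner ℝ e x

/-! ### Sobolev spaces -/

/-- `G` is the weak gradient of `u` on `Ω`:
`∫_Ω u ∂ᵢφ dx = - ∫_Ω Gᵢ φ dx` for all `φ ∈ C_c^∞(Ω)` and all `i`. -/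
def IsWeakGradient {N : ℕ} (Ω : Opens (E N)) (u : E N → ℝ) (G : E N → E N) : Prop :=
  ∀ (φ : 𝓓(Ω, ℝ)) (i : Fin N),
    ∫ x in (Ω : Set (E N)), u x * gradient φ x i = - ∫ x in (Ω : Set (E N)), G x i * φ x

theorem continuous_gradient_testFunction {N : ℕ} {Ω : Opens (E N)} (φ : 𝓓(Ω, ℝ)) :
    Continuous (gradient φ) :=
  (InnerProductSpace.toDual ℝ (E N)).symm.continuous.comp
    (φ.contDiff.continuous_fderiv (by simp))

theorem hasCompactSupport_gradient_testFunction {N : ℕ} {Ω : Opens (E N)} (φ : 𝓓(Ω, ℝ)) :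
    HasCompactSupport (gradient φ) :=
  (φ.hasCompactSupport.fderiv ℝ).comp_left (map_zero (InnerProductSpace.toDual ℝ (E N)).symm)

theorem memLp_testFunction {N : ℕ} {Ω : Opens (E N)} (φ : 𝓓(Ω, ℝ)) : MemLp φ 2 (leb Ω) :=
  φ.continuous.memLp_of_hasCompactSupport φ.hasCompactSupport

theorem memLp_gradient_testFunction {N : ℕ} {Ω : Opens (E N)} (φ : 𝓓(Ω, ℝ)) :
    MemLp (gradient φ) 2 (leb Ω) :=
  (continuous_gradient_testFunction φ).memLp_of_hasCompactSupport
    (hasCompactSupport_gradient_testFunction φ)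

theorem differentiable_testFunction {N : ℕ} {Ω : Opens (E N)} (φ : 𝓓(Ω, ℝ)) :
    Differentiable ℝ φ :=
  φ.contDiff.differentiable (by simp)

/-- The inclusion `φ ↦ (φ, ∇φ)` of `C_c^∞(Ω)` into `L²(Ω) × L²(Ω; ℝ^N)`. -/
def testGraph {N : ℕ} (Ω : Opens (E N)) : 𝓓(Ω, ℝ) →ₗ[ℝ] WithLp 2 (L2 Ω × L2Vec Ω) where
  toFun φ := WithLp.toLp 2
    ((memLp_testFunction φ).toLp _, (memLp_gradient_testFunction φ).toLp _)
  map_add' φ ψ := by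
    have h : gradient (φ + ψ : 𝓓(Ω, ℝ)) = gradient φ + gradient ψ := by
      ext1 x
      have : fderiv ℝ (φ + ψ : 𝓓(Ω, ℝ)) x = fderiv ℝ φ x + fderiv ℝ ψ x :=
        fderiv_add (differentiable_testFunction φ x) (differentiable_testFunction ψ x)
      change (InnerProductSpace.toDual ℝ (E N)).symm _ = _
      rw [this, map_add]
      rfl
    rw [← WithLp.toLp_add, Prod.mk_add_mk, ← MemLp.toLp_add, ← MemLp.toLp_add]
    congr 2
    exact MemLp.toLp_congr _ _ (Filter.EventuallyEq.of_eq h)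
  map_smul' c φ := by
    have h : gradient (c • φ : 𝓓(Ω, ℝ)) = c • gradient φ := by
      ext1 x
      have : fderiv ℝ (c • φ : 𝓓(Ω, ℝ)) x = c • fderiv ℝ φ x :=
        fderiv_const_smul (differentiable_testFunction φ x) c
      change (InnerProductSpace.toDual ℝ (E N)).symm _ = _
      rw [this, map_smul]
      rfl
    rw [RingHom.id_apply, ← WithLp.toLp_smul, Prod.smul_mk, ← MemLp.toLp_const_smul,
      ← MemLp.toLp_const_smul]
    congr 2
    exact MemLp.toLp_congr _ _ (Filter.EventuallyEq.of_eq h)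

/-- The Sobolev space `H^1_0(Ω)`: the closure of `C_c^∞(Ω)` in the `H^1` norm
`(‖y‖²_{L²} + ‖∇y‖²_{L²})^{1/2}`. An element is stored as the pair `(y, ∇y)` of an `L²`
function and its weak gradient; see `IsWeakGradient` and `isWeakGradient_gradOf`. -/
def H10 {N : ℕ} (Ω : Opens (E N)) : Submodule ℝ (WithLp 2 (L2 Ω × L2Vec Ω)) :=
  (LinearMap.range (testGraph Ω)).topologicalClosure

/-- The function underlying an element of `H^1_0(Ω)`. -/
def fnOf {N : ℕ} {Ω : Opens (E N)} (y : H10 Ω) : L2 Ω := (y : WithLp 2 (L2 Ω × L2Vec Ω)).fst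

/-- The gradient of an element of `H^1_0(Ω)`. -/
def gradOf {N : ℕ} {Ω : Opens (E N)} (y : H10 Ω) : L2Vec Ω :=
  (y : WithLp 2 (L2 Ω × L2Vec Ω)).snd

/-- A test function as an element of `H^1_0(Ω)`. -/
def testH10 {N : ℕ} {Ω : Opens (E N)} (φ : 𝓓(Ω, ℝ)) : H10 Ω :=
  ⟨testGraph Ω φ, Submodule.le_topologicalClosure _ ⟨φ, rfl⟩⟩

/-- The space `H^{-1}(Ω)`, the dual of `H^1_0(Ω)`. -/
abbrev Hneg1 {N : ℕ} (Ω : Opens (E N)) : Type := StrongDual ℝ (H10 Ω)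

/-- The second component of an element of `H^1_0(Ω)` is the weak gradient of the first. -/
theorem isWeakGradient_gradOf {N : ℕ} {Ω : Opens (E N)} (y : H10 Ω) :
    IsWeakGradient Ω (fnOf y) (gradOf y) := by
  intro φ i
  have hm1 : MemLp (fun x => gradient φ x i) 2 (leb Ω) :=
    ((EuclideanSpace.proj i : E N →L[ℝ] ℝ).comp_memLp' (memLp_gradient_testFunction φ))
  have hm2 : MemLp (fun x => EuclideanSpace.single i (φ x)) 2 (leb Ω) := by
    have := (ContinuousLinearMap.toSpanSingleton ℝ (EuclideanSpace.single i (1 : ℝ))).comp_memLp'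
      (memLp_testFunction φ)
    refine this.ae_eq (Filter.Eventually.of_forall fun x => ?_)
    ext j
    by_cases h : j = i <;> simp [h]
  have hgr : ∀ (χ : 𝓓(Ω, ℝ)) (x : E N),
      gradient χ x i = fderiv ℝ χ x (EuclideanSpace.single i 1) := by
    intro χ x
    rw [← inner_gradient_left, EuclideanSpace.inner_single_right]
    simp
  have key : ∀ p : WithLp 2 (L2 Ω × L2Vec Ω),
      inner ℝ p (WithLp.toLp 2 (hm1.toLp _, hm2.toLp _)) =
      (∫ x in (Ω : Set (E N)), p.fst x * gradient φ x i)
        + ∫ x in (Ω : Set (E N)), p.snd x i * φ x := by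
    intro p
    rw [WithLp.prod_inner_apply, L2.inner_def, L2.inner_def]
    congr 1
    · refine integral_congr_ae ?_
      filter_upwards [hm1.coeFn_toLp] with x hx
      change inner ℝ (p.fst x) (hm1.toLp _ x) = _
      rw [hx, mul_comm]; rfl
    · refine integral_congr_ae ?_
      filter_upwards [hm2.coeFn_toLp] with x hx
      change inner ℝ (p.snd x) (hm2.toLp _ x) = _
      rw [hx, EuclideanSpace.inner_single_right, mul_comm]; rfl
  have hcl : IsClosed {p : WithLp 2 (L2 Ω × L2Vec Ω) |
      inner ℝ p (WithLp.toLp 2 (hm1.toLp _, hm2.toLp _)) = 0} :=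
    isClosed_eq (by fun_prop) continuous_const
  have hmem : (y : WithLp 2 (L2 Ω × L2Vec Ω)) ∈ {p : WithLp 2 (L2 Ω × L2Vec Ω) |
      inner ℝ p (WithLp.toLp 2 (hm1.toLp _, hm2.toLp _)) = 0} := by
    refine closure_minimal ?_ hcl y.2
    rintro _ ⟨ψ, rfl⟩
    rw [Set.mem_ofPred_eq, key]
    have e1 : ∫ x in (Ω : Set (E N)), (testGraph Ω ψ).fst x * gradient φ x i
        = ∫ x, ψ x * fderiv ℝ φ x (EuclideanSpace.single i 1) := by
      refine Eq.trans ?_ (setIntegral_eq_integral_of_forall_compl_eq_zero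
        (s := (Ω : Set (E N))) ?_)
      · refine integral_congr_ae ?_
        filter_upwards [(memLp_testFunction ψ).coeFn_toLp] with x hx
        change (memLp_testFunction ψ).toLp _ x * _ = _
        rw [hx, hgr]
      · intro x hx
        have : x ∉ tsupport ψ := fun h => hx (ψ.tsupport_subset h)
        simp [image_eq_zero_of_notMem_tsupport this]
    have e2 : ∫ x in (Ω : Set (E N)), (testGraph Ω ψ).snd x i * φ x
        = ∫ x, fderiv ℝ ψ x (EuclideanSpace.single i 1) * φ x := by
      refine Eq.trans ?_ (setIntegral_eq_integral_of_forall_compl_eq_zero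
        (s := (Ω : Set (E N))) ?_)
      · refine integral_congr_ae ?_
        filter_upwards [(memLp_gradient_testFunction ψ).coeFn_toLp] with x hx
        change (memLp_gradient_testFunction ψ).toLp _ x i * _ = _
        rw [hx, hgr]
      · intro x hx
        have : x ∉ tsupport φ := fun h => hx (φ.tsupport_subset h)
        simp [image_eq_zero_of_notMem_tsupport this]
    rw [e1, e2]
    have hcf : ∀ χ : 𝓓(Ω, ℝ), Continuous (fderiv ℝ χ) :=
      fun χ => χ.contDiff.continuous_fderiv (by simp)
    rw [integral_mul_fderiv_eq_neg_fderiv_mul_of_integrable (μ := volume) (𝕜 := ℝ)]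
    · simp
    · refine Continuous.integrable_of_hasCompactSupport ?_ φ.hasCompactSupport.mul_left
      exact ((hcf ψ).clm_apply continuous_const).mul φ.continuous
    · refine Continuous.integrable_of_hasCompactSupport ?_ ψ.hasCompactSupport.mul_right
      exact ψ.continuous.mul ((hcf φ).clm_apply continuous_const)
    · exact (ψ.continuous.mul φ.continuous).integrable_of_hasCompactSupport
        ψ.hasCompactSupport.mul_right
    · exact fun x _ => differentiable_testFunction ψ x
    · exact fun x _ => differentiable_testFunction φ x
  rw [Set.mem_ofPred_eq, key] at hmem
  exact eq_neg_of_add_eq_zero_left hmem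

/-! ### Total variation -/

/-- The divergence of a vector field. -/
def divergence {N : ℕ} (Φ : E N → E N) (x : E N) : ℝ :=
  ∑ i, fderiv ℝ Φ x (EuclideanSpace.single i 1) i

/-- The total variation `TV(f) = sup {∫_Ω f div Φ dx : Φ ∈ C_c^1(Ω; ℝ^N), |Φ| ≤ 1}`,
as an element of `[0, ∞]`. -/
def totalVariation {N : ℕ} (Ω : Opens (E N)) (f : E N → ℝ) : ℝ≥0∞ :=
  ⨆ (Φ : 𝓓^{1}(Ω, E N)) (_ : ∀ x, ‖Φ x‖ ≤ 1),
    ENNReal.ofReal (∫ x in (Ω : Set (E N)), f x * divergence Φ x)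

/-! ### Matrix fields and the admissible controls -/

/-- The form `(η, M ξ)_{ℝ^N}`. -/
def matForm {N : ℕ} (M : Mat N) (η ξ : E N) : ℝ := WithLp.ofLp η ⬝ᵥ (M *ᵥ WithLp.ofLp ξ)

/-- `M^{sym} = (M + Mᵗ) / 2`. -/
def symPart {N : ℕ} (M : Mat N) : Mat N := (1 / 2 : ℝ) • (M + Mᵀ)

/-- `M^{skew} = (M - Mᵗ) / 2`, as a linear map. -/
def skewPartₗ (N : ℕ) : Mat N →ₗ[ℝ] Mat N where
  toFun M := (1 / 2 : ℝ) • (M - Mᵀ)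
  map_add' A B := by rw [Matrix.transpose_add]; module
  map_smul' c A := by rw [Matrix.transpose_smul, RingHom.id_apply]; module

/-- The skew-symmetric part `A^{skew} ∈ L²(Ω; 𝕄^N)` of `A ∈ L²(Ω; 𝕄^N)`. -/
def skewField {N : ℕ} {Ω : Opens (E N)} (A : L2Mat Ω) : L2Mat Ω :=
  (LinearMap.toContinuousLinearMap (skewPartₗ N)).compLp A

/-- The symmetric part of a matrix field. -/
def symField {N : ℕ} {Ω : Opens (E N)} (A : L2Mat Ω) (x : E N) : Mat N := symPart (A x)

/-- `A` takes values in the skew-symmetric matrices, i.e. `A ∈ L²(Ω; 𝕊^N_skew)`. -/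
def IsSkewField {N : ℕ} {Ω : Opens (E N)} (A : L2Mat Ω) : Prop :=
  ∀ᵐ x ∂(leb Ω), (A x)ᵀ = - A x

/-- The relation `A ⪯ B` a.e. in `Ω`. -/
def DominatedBy {N : ℕ} {Ω : Opens (E N)} (A B : L2Mat Ω) : Prop :=
  ∀ᵐ x ∂(leb Ω), ∀ i j : Fin N, i < j → |A x i j| ≤ |B x i j|

/-- The class `𝔐_α^β(Ω)`: `S ∈ L^∞(Ω; 𝕊^N_sym)` with `α I ≤ S ≤ β I` a.e. in `Ω`, in the sense
of quadratic forms. -/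
def MemMαβ {N : ℕ} (Ω : Opens (E N)) (α β : ℝ) (S : E N → Mat N) : Prop :=
  MemLp S ∞ (leb Ω) ∧ (∀ᵐ x ∂(leb Ω), (S x)ᵀ = S x) ∧
    ∀ᵐ x ∂(leb Ω), ∀ ξ : E N, α * ‖ξ‖ ^ 2 ≤ matForm (S x) ξ ξ ∧ matForm (S x) ξ ξ ≤ β * ‖ξ‖ ^ 2

/-- The admissible controls: `A^{sym} ∈ 𝔐_α^β(Ω)` with all entries of total variation at most `c`,
and `A^{skew} ∈ Q` with `A^{skew} ⪯ A*`. -/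
def admissibleControls {N : ℕ} (Ω : Opens (E N)) (α β c : ℝ) (Astar : L2Mat Ω)
    (Q : Set (L2Mat Ω)) : Set (L2Mat Ω) :=
  {A | (∀ i j : Fin N, i ≤ j →
          totalVariation Ω (fun x => symField A x i j) ≤ ENNReal.ofReal c) ∧
       MemMαβ Ω α β (symField A) ∧
       DominatedBy (skewField A) Astar ∧
       skewField A ∈ Q}

/-! ### The state equation and the optimal control problem -/

/-- `[y, φ]_A = ∫_Ω (∇φ, A^{skew} ∇y) dx` for a test function `φ`. -/
def skewFormTest {N : ℕ} {Ω : Opens (E N)} (A : L2Mat Ω) (y : H10 Ω) (φ : 𝓓(Ω, ℝ)) : ℝ :=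
  ∫ x in (Ω : Set (E N)), matForm (skewField A x) (gradient φ x) (gradOf y x)

/-- The set `D(A)` of the `y ∈ H^1_0(Ω)` such that, for some constant `k`,
`|[y, φ]_A| ≤ k ‖∇φ‖_{L²}` for all `φ ∈ C_c^∞(Ω)`. -/
def domain {N : ℕ} {Ω : Opens (E N)} (A : L2Mat Ω) : Set (H10 Ω) :=
  {y | ∃ k : ℝ, ∀ φ : 𝓓(Ω, ℝ),
    |skewFormTest A y φ| ≤ k * Real.sqrt (∫ x in (Ω : Set (E N)), ‖gradient φ x‖ ^ 2)}

/-- The extension of `[y, ·]_A` to `φ ∈ H^1_0(Ω)`: the limit of `[y, ψ]_A` as the test function `ψ`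
tends to `φ` in `H^1_0(Ω)`. The limit exists for `y ∈ D(A)`; it is used only for such `y`. -/
def skewForm {N : ℕ} {Ω : Opens (E N)} (A : L2Mat Ω) (y φ : H10 Ω) : ℝ :=
  limUnder (comap (testH10 (Ω := Ω)) (𝓝 φ)) (skewFormTest A y)

/-- The set `Ξ` of admissible pairs `(A, y)`: `A` is an admissible control, `y ∈ D(A)`, and
`∫_Ω (∇φ, A^{sym} ∇y) dx + [y, φ]_A = ⟨f, φ⟩` for all `φ ∈ H^1_0(Ω)`. -/
def admissiblePairs {N : ℕ} (Ω : Opens (E N)) (α β c : ℝ) (Astar : L2Mat Ω)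
    (Q : Set (L2Mat Ω)) (f : Hneg1 Ω) : Set (L2Mat Ω × H10 Ω) :=
  {p | p.1 ∈ admissibleControls Ω α β c Astar Q ∧ p.2 ∈ domain p.1 ∧
    ∀ φ : H10 Ω,
      (∫ x in (Ω : Set (E N)), matForm (symField p.1 x) (gradOf φ x) (gradOf p.2 x))
        + skewForm p.1 p.2 φ = f φ}

/-- The cost `I(A, y) = ‖y - y_d‖²_{L²(Ω)} + ∫_Ω (∇y, A^{sym} ∇y) dx`. -/
def cost {N : ℕ} {Ω : Opens (E N)} (yd : L2 Ω) (p : L2Mat Ω × H10 Ω) : ℝ :=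
  ‖fnOf p.2 - yd‖ ^ 2
    + ∫ x in (Ω : Set (E N)), matForm (symField p.1 x) (gradOf p.2 x) (gradOf p.2 x)

/-- `p` is an optimal pair: `p ∈ Ξ` and `I(p) = inf_{Ξ} I`. -/
def IsOptimalPair {N : ℕ} (Ω : Opens (E N)) (α β c : ℝ) (Astar : L2Mat Ω)
    (Q : Set (L2Mat Ω)) (f : Hneg1 Ω) (yd : L2 Ω) (p : L2Mat Ω × H10 Ω) : Prop :=
  p ∈ admissiblePairs Ω α β c Astar Q f ∧
    IsGLB (cost yd '' admissiblePairs Ω α β c Astar Q f) (cost yd p)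

end

end OCP

open OCP

/-!
The proof is the direct method: a minimizing sequence `(A_k, y_k)` has a limit, the limit is
admissible, and the cost is lower semicontinuous along the sequence.

The set of admissible controls is compact in `L²(Ω; 𝕄^N)` (`isCompact_admissibleControls`). The
skew parts lie in the compact set `Q`. The entries of the symmetric parts are uniformly bounded,
because of the form bounds, and have bounded total variation, so that they lie in a compact subset
of `L²(Ω)` (`isCompact_setOf_variationLE`). The latter is the compactness of `BV`, here for bounded
functions on a set of finite measure, where no boundary regularity is involved: a bound on the
variation of `g` bounds `∫_Ω g (u(· - z) - u)` by `|z| sup |u|` for `u` with compact support in `Ω`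
(`VariationLE.abs_integral_translate_sub_le`). So for `u = 1_K g` averaging over balls of radius `ε`
changes `∫_Ω g u` by `O(ε)` only, while averages turn weak convergence into pointwise convergence.

The cost bounds `y_k` in the `H^1` norm, so a subsequence converges weakly to some `y`. For a
fixed test function `φ` the fields `A_kᵗ ∇φ` converge strongly in `L²`, so the equation passes to
the limit (`mem_admissiblePairs_of_tendsto`). The limit equation then yields `y ∈ D(A)`, since `f` is
bounded by `‖∇φ‖` on test functions, as one sees from the equation for any given admissible pair;
and both sides extend by density to all of `H^1_0(Ω)`. Lower semicontinuity
(`cost_le_of_tendsto`) follows from the inequality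
`(∇y_k, S_k ∇y_k) ≥ 2 (∇y_k, S_k ∇y) - (∇y, S_k ∇y)` with `S_k = A_k^{sym}`, since
`S_k ∇y → S ∇y` strongly in `L²`.
-/

/-! ### Weak convergence in Hilbert spaces -/

theorem exists_subseq_tendsto_inner {H : Type*} [NormedAddCommGroup H] [InnerProductSpace ℝ H]
    [CompleteSpace H] [SeparableSpace H] {x : ℕ → H} {R : ℝ} (hx : ∀ k, ‖x k‖ ≤ R) :
    ∃ (a : H) (s : ℕ → ℕ), StrictMono s ∧
      ∀ h : H, Tendsto (fun k => inner ℝ (x (s k)) h) atTop (𝓝 (inner ℝ a h)) := by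
  have hmem : ∀ k, StrongDual.toWeakDual (InnerProductSpace.toDual ℝ H (x k)) ∈
      WeakDual.toStrongDual ⁻¹' Metric.closedBall (0 : StrongDual ℝ H) R := by
    intro k
    simpa using hx k
  obtain ⟨b, -, s, hs, hb⟩ := WeakDual.isSeqCompact_closedBall ℝ H 0 R hmem
  refine ⟨(InnerProductSpace.toDual ℝ H).symm (WeakDual.toStrongDual b), s, hs, fun h => ?_⟩
  have := ((WeakDual.eval_continuous h).tendsto b).comp hb
  simpa [Function.comp_def] using this

theorem tendsto_inner_of_tendsto_inner {H : Type*} [NormedAddCommGroup H]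
    [InnerProductSpace ℝ H] {x w : ℕ → H} {a b : H} {R : ℝ} (hR : ∀ k, ‖x k‖ ≤ R)
    (hx : ∀ h : H, Tendsto (fun k => inner ℝ (x k) h) atTop (𝓝 (inner ℝ a h)))
    (hw : Tendsto w atTop (𝓝 b)) :
    Tendsto (fun k => inner ℝ (x k) (w k)) atTop (𝓝 (inner ℝ a b)) := by
  have h1 : Tendsto (fun k => inner ℝ (x k) (w k - b)) atTop (𝓝 0) := by
    have h2 : Tendsto (fun k => R * ‖w k - b‖) atTop (𝓝 0) := by
      have := (tendsto_iff_norm_sub_tendsto_zero.1 hw).const_mul R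
      simpa using this
    refine squeeze_zero_norm (fun k => ?_) h2
    exact (norm_inner_le_norm _ _).trans (mul_le_mul_of_nonneg_right (hR k) (norm_nonneg _))
  have h3 := h1.add (hx b)
  simpa [inner_sub_right] using h3

/-! ### Functions of bounded variation and translations -/

/-- `|∫_Ω g div Φ dx| ≤ C` for all `Φ ∈ C_c^1(Ω; ℝ^N)` with `|Φ| ≤ 1`: the total variation of `g`
is at most `C`. -/
def VariationLE {N : ℕ} (Ω : Opens (E N)) (g : E N → ℝ) (C : ℝ) : Prop :=
  ∀ Φ : 𝓓^{1}(Ω, E N), (∀ x, ‖Φ x‖ ≤ 1) →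
    |∫ x in (Ω : Set (E N)), g x * divergence Φ x| ≤ C

theorem divergence_const_smul {N : ℕ} (r : ℝ) {Φ : E N → E N} (hΦ : Differentiable ℝ Φ)
    (x : E N) : divergence (r • Φ) x = r * divergence Φ x := by
  simp only [divergence, Finset.mul_sum]
  refine Finset.sum_congr rfl fun i _ => ?_
  rw [fderiv_const_smul (hΦ x)]
  simp

theorem differentiable_testField {N : ℕ} {Ω : Opens (E N)} (Φ : 𝓓^{1}(Ω, E N)) :
    Differentiable ℝ Φ :=
  Φ.contDiff.differentiable (by simp)

theorem divergence_smul_const {N : ℕ} {η : E N → ℝ} (hη : Differentiable ℝ η) (z x : E N) :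
    divergence (fun y => η y • z) x = fderiv ℝ η x z := by
  have h : fderiv ℝ (fun y => η y • z) x = (fderiv ℝ η x).smulRight z :=
    ((hη x).hasFDerivAt.smul_const z).fderiv
  have hz : z = ∑ i, z i • EuclideanSpace.single i (1 : ℝ) := by
    ext j
    simp [Pi.single_apply]
  conv_rhs => rw [hz, map_sum]
  simp only [divergence, h]
  refine Finset.sum_congr rfl fun i _ => ?_
  simp [mul_comm]

theorem totalVariation_le_iff {N : ℕ} {Ω : Opens (E N)} {g : E N → ℝ} {c : ℝ} (hc : 0 ≤ c) :
    totalVariation Ω g ≤ ENNReal.ofReal c ↔ VariationLE Ω g c := by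
  simp only [totalVariation, iSup_le_iff, ENNReal.ofReal_le_ofReal_iff hc]
  refine ⟨fun h Φ hΦ => abs_le.2 ⟨?_, h Φ hΦ⟩, fun h Φ hΦ => (abs_le.1 (h Φ hΦ)).2⟩
  have h1 := h ((-1 : ℝ) • Φ) (fun x => by simpa using hΦ x)
  have h2 : ∀ x, divergence ((-1 : ℝ) • Φ : 𝓓^{1}(Ω, E N)) x = -1 * divergence Φ x :=
    divergence_const_smul (-1) (differentiable_testField Φ)
  simp only [h2] at h1
  have h3 : ∀ x, g x * (-1 * divergence Φ x) = -(g x * divergence Φ x) := fun x => by ring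
  simp only [h3, integral_neg] at h1
  linarith

theorem VariationLE.abs_integral_le {N : ℕ} {Ω : Opens (E N)} {g : E N → ℝ} {C : ℝ}
    (hg : VariationLE Ω g C) {R : ℝ} (hR : 0 < R) (Φ : 𝓓^{1}(Ω, E N)) (hΦ : ∀ x, ‖Φ x‖ ≤ R) :
    |∫ x in (Ω : Set (E N)), g x * divergence Φ x| ≤ C * R := by
  have h1 := hg (R⁻¹ • Φ) (fun x => by
    have : ‖(R⁻¹ • Φ : 𝓓^{1}(Ω, E N)) x‖ = R⁻¹ * ‖Φ x‖ := by
      change ‖R⁻¹ • Φ x‖ = _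
      rw [norm_smul, Real.norm_of_nonneg (by positivity)]
    rw [this, inv_mul_le_iff₀ hR]
    simpa using hΦ x)
  have h2 : ∀ x, divergence (R⁻¹ • Φ : 𝓓^{1}(Ω, E N)) x = R⁻¹ * divergence Φ x :=
    divergence_const_smul R⁻¹ (differentiable_testField Φ)
  have h3 : ∀ x, g x * (R⁻¹ * divergence Φ x) = R⁻¹ * (g x * divergence Φ x) := fun x => by ring
  simp only [h2, h3] at h1
  rw [integral_const_mul, abs_mul, abs_of_pos (inv_pos.2 hR), inv_mul_le_iff₀ hR] at h1
  linarith

/-- `∫_Ω g(x) ψ(x - tz) dx` has `t`-derivative `-∫_Ω g div (ψ(· - tz) z) dx`, so its increment over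
`[0, 1]` is controlled by the variation of `g`. -/
theorem VariationLE.abs_integral_translate_sub_le_of_contDiff {N : ℕ} {Ω : Opens (E N)}
    {g : E N → ℝ} {C : ℝ} (hg : VariationLE Ω g C) (hgi : Integrable g (leb Ω))
    {ψ : E N → ℝ} (hψ : ContDiff ℝ 1 ψ) (hψc : HasCompactSupport ψ) {M : ℝ} (hM : 0 < M)
    (hψM : ∀ x, |ψ x| ≤ M) {z : E N}
    (hz : ∀ t ∈ Set.Icc (0 : ℝ) 1, ∀ x ∈ tsupport ψ, x + t • z ∈ Ω) :
    |∫ x in (Ω : Set (E N)), g x * (ψ (x - z) - ψ x)| ≤ C * (M * ‖z‖) := by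
  rcases eq_or_ne z 0 with rfl | hz0
  · simp
  have hz0' : 0 < ‖z‖ := norm_pos_iff.2 hz0
  have hψ0 : Continuous ψ := hψ.continuous
  have hd : Differentiable ℝ ψ := hψ.differentiable (by simp)
  have hdc : Continuous (fderiv ℝ ψ) := hψ.continuous_fderiv (by simp)
  obtain ⟨B, hB⟩ := (hψc.fderiv ℝ).exists_bound_of_continuous hdc
  have hint : ∀ t : ℝ, Integrable (fun x => g x * ψ (x - t • z)) (leb Ω) := fun t =>
    hgi.mul_bdd (c := M) (Continuous.aestronglyMeasurable (by fun_prop))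
      (Eventually.of_forall fun x => hψM _)
  have hder : ∀ t : ℝ, HasDerivAt (fun t : ℝ => ∫ x in (Ω : Set (E N)), g x * ψ (x - t • z))
      (∫ x in (Ω : Set (E N)), g x * fderiv ℝ ψ (x - t • z) (-z)) t := by
    intro t
    refine (hasDerivAt_integral_of_dominated_loc_of_deriv_le (s := Set.univ)
      (F' := fun t x => g x * fderiv ℝ ψ (x - t • z) (-z))
      (bound := fun x => ‖g x‖ * (B * ‖z‖))
      univ_mem (Eventually.of_forall fun t => (hint t).aestronglyMeasurable) (hint t) ?_ ?_ ?_
      ?_).2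
    · refine hgi.aestronglyMeasurable.mul (Continuous.aestronglyMeasurable ?_)
      exact (hdc.comp (by fun_prop)).clm_apply continuous_const
    · refine Eventually.of_forall fun x t _ => ?_
      rw [norm_mul]
      refine mul_le_mul_of_nonneg_left ?_ (norm_nonneg _)
      refine ((fderiv ℝ ψ (x - t • z)).le_opNorm _).trans ?_
      rw [norm_neg]
      exact mul_le_mul_of_nonneg_right (hB _) (norm_nonneg _)
    · exact hgi.norm.mul_const _
    · refine Eventually.of_forall fun x t _ => ?_
      have h1 : HasDerivAt (fun t : ℝ => x - t • z) (-z) t := by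
        simpa using ((hasDerivAt_id t).smul_const z).const_sub x
      exact ((hd _).hasFDerivAt.comp_hasDerivAt t h1).const_mul (g x)
  have hbound : ∀ t ∈ Set.Ico (0 : ℝ) 1,
      ‖∫ x in (Ω : Set (E N)), g x * fderiv ℝ ψ (x - t • z) (-z)‖ ≤ C * (M * ‖z‖) := by
    intro t ht
    have hη : ContDiff ℝ 1 (fun x => ψ (x - t • z)) := hψ.comp (by fun_prop)
    have hcs : HasCompactSupport (fun x => ψ (x - t • z)) :=
      hψc.comp_homeomorph (Homeomorph.subRight (t • z))
    have hts : tsupport (fun x => ψ (x - t • z)) ⊆ (Ω : Set (E N)) := by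
      intro x hx
      have : x - t • z ∈ tsupport ψ :=
        tsupport_comp_subset_preimage ψ (f := fun x => x - t • z) (by fun_prop) hx
      simpa using hz t ⟨ht.1, ht.2.le⟩ _ this
    let Φ : 𝓓^{1}(Ω, E N) :=
      ⟨fun x => ψ (x - t • z) • z, hη.smul contDiff_const, hcs.smul_right,
        (tsupport_smul_subset_left _ _).trans hts⟩
    have h1 := hg.abs_integral_le (R := M * ‖z‖) (by positivity) Φ (fun x => by
      change ‖ψ (x - t • z) • z‖ ≤ _
      rw [norm_smul]
      exact mul_le_mul_of_nonneg_right (hψM _) (norm_nonneg _))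
    have h2 : ∀ x, divergence Φ x = fderiv ℝ ψ (x - t • z) z := by
      intro x
      refine (divergence_smul_const (hη.differentiable (by simp)) z x).trans ?_
      rw [fderiv_comp_sub]
    simp only [h2] at h1
    simpa [integral_neg] using h1
  have := norm_image_sub_le_of_norm_deriv_le_segment_01'
    (fun t _ => (hder t).hasDerivWithinAt) hbound
  rw [← integral_sub (hint 1) (hint 0)] at this
  simpa [mul_sub] using this

open scoped Convolution in
/-- The smooth case, applied to mollifications of `u`. -/
theorem VariationLE.abs_integral_translate_sub_le {N : ℕ} {Ω : Opens (E N)}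
    {g : E N → ℝ} {C : ℝ} (hg : VariationLE Ω g C) (hgi : Integrable g (leb Ω))
    {u : E N → ℝ} (hum : StronglyMeasurable u) {M : ℝ} (hM : 0 < M)
    (huM : ∀ᵐ x, |u x| ≤ M) {K : Set (E N)} (hK : IsCompact K) (huK : ∀ x ∉ K, u x = 0)
    {r : ℝ} (hr : 0 < r) (hrK : Metric.cthickening r K ⊆ Ω) {z : E N} (hz : ‖z‖ ≤ r / 2) :
    |∫ x in (Ω : Set (E N)), g x * (u (x - z) - u x)| ≤ C * (M * ‖z‖) := by
  have hui : Integrable u := by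
    have : IntegrableOn u K :=
      Measure.integrableOn_of_bounded (M := M) hK.measure_lt_top.ne hum.aestronglyMeasurable
        (ae_restrict_of_ae huM)
    exact this.integrable_of_forall_notMem_eq_zero huK
  have huc : HasCompactSupport u := HasCompactSupport.intro hK huK
  -- Mollifiers of radius at most `r / 2`, so that translates by `t z`, `t ≤ 1`, stay within `r` of
  -- `K`; the ratio of outer to inner radius is fixed, for the convergence almost everywhere.
  let ρ : ℕ → ContDiffBump (0 : E N) := fun j =>
    ⟨r / 4 / (j + 1), r / 2 / (j + 1), by positivity, by gcongr; norm_num⟩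
  have hρr : ∀ j, (ρ j).rOut ≤ r / 2 := by
    intro j
    change r / 2 / ((j : ℝ) + 1) ≤ r / 2
    exact div_le_self (by positivity) (by linarith [Nat.cast_nonneg (α := ℝ) j])
  have hρ0 : Tendsto (fun j => (ρ j).rOut) atTop (𝓝 0) := by
    have := (tendsto_one_div_add_atTop_nhds_zero_nat (𝕜 := ℝ)).const_mul (r / 2)
    simpa [ρ, div_eq_mul_inv] using this
  let ψ : ℕ → E N → ℝ := fun j =>
    ((ρ j).normed volume) ⋆[ContinuousLinearMap.lsmul ℝ ℝ, volume] u
  have hψC : ∀ j, ContDiff ℝ 1 (ψ j) := fun j =>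
    HasCompactSupport.contDiff_convolution_left _ (ρ j).hasCompactSupport_normed
      (ρ j).contDiff_normed hui.locallyIntegrable
  have hψc : ∀ j, HasCompactSupport (ψ j) := fun j =>
    HasCompactSupport.convolution _ (ρ j).hasCompactSupport_normed huc
  have hψM : ∀ j x, |ψ j x| ≤ M := by
    intro j x
    have h1 : ∀ᵐ t : E N, ‖(ContinuousLinearMap.lsmul ℝ ℝ) ((ρ j).normed volume t) (u (x - t))‖ ≤
        (ρ j).normed volume t * M := by
      have h2 : ∀ᵐ t : E N, |u (x - t)| ≤ M :=
        (Measure.measurePreserving_sub_left volume x).quasiMeasurePreserving.ae huM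
      filter_upwards [h2] with t ht
      rw [ContinuousLinearMap.lsmul_apply, norm_smul,
        Real.norm_of_nonneg ((ρ j).nonneg_normed t)]
      exact mul_le_mul_of_nonneg_left ht ((ρ j).nonneg_normed t)
    refine (norm_integral_le_of_norm_le ((ρ j).integrable_normed.mul_const M) h1).trans ?_
    rw [integral_mul_const, (ρ j).integral_normed, one_mul]
  have hψs : ∀ j, tsupport (ψ j) ⊆ Metric.cthickening (r / 2) K := by
    intro j
    refine closure_minimal (fun x hx => ?_) Metric.isClosed_cthickening
    obtain ⟨a, ha, b, hb, rfl⟩ := support_convolution_subset _ hx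
    rw [(ρ j).support_normed_eq, mem_ball_zero_iff] at ha
    have hbK : b ∈ K := by
      by_contra h
      exact hb (huK b h)
    refine Metric.mem_cthickening_of_dist_le _ b _ _ hbK ?_
    rw [dist_eq_norm, add_sub_cancel_right]
    exact ha.le.trans (hρr j)
  have hψz : ∀ j, ∀ t ∈ Set.Icc (0 : ℝ) 1, ∀ x ∈ tsupport (ψ j), x + t • z ∈ Ω := by
    intro j t ht x hx
    have hx' := hψs j hx
    rw [hK.cthickening_eq_biUnion_closedBall (by positivity)] at hx'
    obtain ⟨b, hbK, hb⟩ := Set.mem_iUnion₂.1 hx'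
    refine hrK (Metric.mem_cthickening_of_dist_le _ b _ _ hbK ?_)
    rw [Metric.mem_closedBall] at hb
    have h1 : dist (x + t • z) b ≤ dist (x + t • z) x + dist x b := dist_triangle _ _ _
    have h2 : dist (x + t • z) x = t * ‖z‖ := by
      rw [dist_eq_norm, add_sub_cancel_left, norm_smul, Real.norm_of_nonneg ht.1]
    have h3 : t * ‖z‖ ≤ 1 * ‖z‖ := mul_le_mul_of_nonneg_right ht.2 (norm_nonneg _)
    linarith
  have hlim : ∀ᵐ x : E N, Tendsto (fun j => ψ j x) atTop (𝓝 (u x)) :=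
    ContDiffBump.ae_convolution_tendsto_right_of_locallyIntegrable (K := 2) hρ0
      (Eventually.of_forall fun j => by
        change r / 2 / ((j : ℝ) + 1) ≤ 2 * (r / 4 / (j + 1))
        apply le_of_eq
        ring) hui.locallyIntegrable
  have hlimz : ∀ᵐ x : E N, Tendsto (fun j => ψ j (x - z)) atTop (𝓝 (u (x - z))) :=
    (measurePreserving_sub_right volume z).quasiMeasurePreserving.ae hlim
  have hconv : Tendsto (fun j => ∫ x in (Ω : Set (E N)), g x * (ψ j (x - z) - ψ j x)) atTop
      (𝓝 (∫ x in (Ω : Set (E N)), g x * (u (x - z) - u x))) := by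
    refine tendsto_integral_of_dominated_convergence (fun x => ‖g x‖ * (M + M)) ?_
      (hgi.norm.mul_const _) ?_ ?_
    · intro j
      have := (hψC j).continuous
      exact hgi.aestronglyMeasurable.mul (Continuous.aestronglyMeasurable (by fun_prop))
    · intro j
      refine Eventually.of_forall fun x => ?_
      rw [norm_mul]
      refine mul_le_mul_of_nonneg_left ?_ (norm_nonneg _)
      exact (norm_sub_le _ _).trans (add_le_add (hψM _ _) (hψM _ _))
    · filter_upwards [ae_restrict_of_ae hlim, ae_restrict_of_ae hlimz] with x h1 h2
      exact (h2.sub h1).const_mul _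
  refine le_of_tendsto hconv.abs (Eventually.of_forall fun j => ?_)
  exact hg.abs_integral_translate_sub_le_of_contDiff hgi (hψC j) (hψc j) hM (hψM j) (hψz j)

/-- On a compact subset `K` of `Ω`, `∫_K g_k² = ∫_Ω g_k (u_k - A u_k) + ∫_Ω g_k A u_k` with
`u_k = 1_K g_k` and `A` the average over balls of radius `ε`. The first term is `O(ε)` by the bound
on the variation, and `A u_k → 0` pointwise by weak convergence. -/
theorem tendsto_setIntegral_sq_of_variationLE {N : ℕ} {Ω : Opens (E N)}
    (hΩ : volume (Ω : Set (E N)) ≠ ∞) {g : ℕ → E N → ℝ} (hgm : ∀ k, StronglyMeasurable (g k))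
    {M C : ℝ} (hM : 0 < M) (hC : 0 ≤ C) (hgM : ∀ k, ∀ᵐ x ∂(leb Ω), |g k x| ≤ M)
    (hgC : ∀ k, VariationLE Ω (g k) C)
    (hg0 : ∀ s : Set (E N), MeasurableSet s →
      Tendsto (fun k => ∫ x in s, g k x ∂(leb Ω)) atTop (𝓝 0))
    {K : Set (E N)} (hK : IsCompact K) (hKΩ : K ⊆ Ω) :
    Tendsto (fun k => ∫ x in K, g k x ^ 2) atTop (𝓝 0) := by
  have : IsFiniteMeasure (leb Ω) := ⟨by simpa using hΩ.lt_top⟩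
  obtain ⟨r, hr, hrK⟩ := hK.exists_cthickening_subset_open Ω.isOpen hKΩ
  have hKm := hK.measurableSet
  have hgi : ∀ k, Integrable (g k) (leb Ω) := fun k =>
    Integrable.of_bound (hgm k).aestronglyMeasurable M (hgM k)
  let u : ℕ → E N → ℝ := fun k => K.indicator (g k)
  have hum : ∀ k, StronglyMeasurable (u k) := fun k => (hgm k).indicator hKm
  have huM : ∀ k, ∀ᵐ x, |u k x| ≤ M := by
    intro k
    filter_upwards [(ae_restrict_iff' Ω.isOpen.measurableSet).1 (hgM k)] with x hx
    by_cases h : x ∈ K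
    · simpa [u, h] using hx (hKΩ h)
    · simpa [u, h] using hM.le
  have huK : ∀ k, ∀ x ∉ K, u k x = 0 := fun k x hx => by simp [u, hx]
  have husq : ∀ k, ∫ x in K, g k x ^ 2 = ∫ x in (Ω : Set (E N)), g k x * u k x := by
    intro k
    have h1 : ∀ x, g k x * u k x = K.indicator (fun x => g k x ^ 2) x := by
      intro x
      by_cases h : x ∈ K <;> simp [u, h, sq]
    simp only [h1]
    rw [setIntegral_indicator hKm, Set.inter_eq_right.2 hKΩ]
  have hav : ∀ (ε : ℝ) (k : ℕ) (x : E N),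
      ∫ w in Metric.closedBall (0 : E N) ε, u k (x - w)
        = ∫ y in Metric.closedBall x ε ∩ K, g k y ∂(leb Ω) := by
    intro ε k x
    rw [← integral_indicator Metric.isClosed_closedBall.measurableSet,
      Measure.restrict_restrict (Metric.isClosed_closedBall.measurableSet.inter hKm),
      Set.inter_eq_left.2 (Set.inter_subset_right.trans hKΩ), ← setIntegral_indicator hKm,
      ← integral_indicator Metric.isClosed_closedBall.measurableSet,
      ← integral_sub_left_eq_self _ volume x]
    refine integral_congr_ae (Eventually.of_forall fun w => ?_)
    have h1 : x - w ∈ Metric.closedBall (0 : E N) ε ↔ w ∈ Metric.closedBall x ε := by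
      rw [mem_closedBall_zero_iff, mem_closedBall_iff_norm, norm_sub_rev]
    by_cases h : w ∈ Metric.closedBall x ε
    · beta_reduce
      rw [Set.indicator_of_mem (h1.2 h), Set.indicator_of_mem h, sub_sub_cancel]
    · beta_reduce
      rw [Set.indicator_of_notMem (mt h1.1 h), Set.indicator_of_notMem h]
  rw [Metric.tendsto_atTop']
  intro η hη
  -- `ε ≤ r / 2` keeps the translates inside `Ω`, and `C M ε < η / 2` bounds the first term.
  set ε : ℝ := min (r / 2) (η / (2 * (C * M + 1))) with hε
  have hCM : 0 ≤ C * M := by positivity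
  have hε0 : 0 < ε := lt_min (by positivity) (by positivity)
  have hεη : C * (M * ε) < η / 2 := by
    have h1 : ε ≤ η / (2 * (C * M + 1)) := min_le_right _ _
    rw [le_div_iff₀ (by positivity)] at h1
    nlinarith
  set B : Set (E N) := Metric.closedBall (0 : E N) ε with hB
  have hBt : volume B ≠ ∞ := measure_closedBall_lt_top.ne
  have hBfin : IsFiniteMeasure (volume.restrict B) := ⟨by simpa using hBt.lt_top⟩
  set v : ℝ := volume.real B with hv
  have hv0 : 0 < v :=
    ENNReal.toReal_pos (Metric.measure_closedBall_pos volume _ hε0).ne' hBt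
  let a : ℕ → E N → ℝ := fun k x => ∫ w in B, u k (x - w)
  have ham : ∀ k, StronglyMeasurable (a k) := fun k =>
    StronglyMeasurable.integral_prod_right (f := fun x w => u k (x - w))
      ((hum k).comp_measurable (measurable_fst.sub measurable_snd))
  have haM : ∀ k x, |a k x| ≤ M * v := by
    intro k x
    have h1 : ∀ᵐ w, ‖u k (x - w)‖ ≤ M :=
      (Measure.measurePreserving_sub_left volume x).quasiMeasurePreserving.ae (huM k)
    have := norm_integral_le_of_norm_le_const (μ := volume.restrict B) (ae_restrict_of_ae h1)
    simpa [v, measureReal_def] using this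
  have ha0 : ∀ x, Tendsto (fun k => a k x) atTop (𝓝 0) := by
    intro x
    simp only [a, B, hav]
    exact hg0 _ (Metric.isClosed_closedBall.measurableSet.inter hKm)
  have hga : Tendsto (fun k => ∫ x in (Ω : Set (E N)), g k x * a k x) atTop (𝓝 0) := by
    have h1 : Tendsto (fun k => ∫ x in (Ω : Set (E N)), g k x * a k x) atTop
        (𝓝 (∫ x in (Ω : Set (E N)), (0 : ℝ))) := by
      refine tendsto_integral_of_dominated_convergence (fun _ => M * (M * v))
        (fun k => ((hgm k).mul (ham k)).aestronglyMeasurable) (integrable_const _) ?_ ?_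
      · intro k
        filter_upwards [hgM k] with x hx
        rw [norm_mul]
        exact mul_le_mul hx (haM k x) (norm_nonneg _) hM.le
      · filter_upwards [ae_all_iff.2 hgM] with x hx
        have h2 : Tendsto (fun k => M * |a k x|) atTop (𝓝 0) := by
          simpa using (ha0 x).abs.const_mul M
        refine squeeze_zero_norm (fun k => ?_) h2
        rw [norm_mul]
        exact mul_le_mul_of_nonneg_right (hx k) (abs_nonneg _)
    simpa using h1
  -- The bound for single translations, integrated over `w ∈ B`.
  have hmain : ∀ k, v * (∫ x in K, g k x ^ 2) ≤
      C * (M * ε) * v + |∫ x in (Ω : Set (E N)), g k x * a k x| := by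
    intro k
    have hi1 : Integrable (fun p : E N × E N => g k p.1 * u k (p.1 - p.2))
        ((leb Ω).prod (volume.restrict B)) := by
      have h1 : Integrable (fun p : E N × E N => g k p.1) ((leb Ω).prod (volume.restrict B)) :=
        (hgi k).comp_fst _
      have h2 : ∀ᵐ p ∂((leb Ω).prod (volume.restrict B)), ‖u k (p.1 - p.2)‖ ≤ M := by
        have h3 : ∀ᵐ p : E N × E N, ‖u k (p.1 - p.2)‖ ≤ M :=
          (quasiMeasurePreserving_sub volume volume).ae (huM k)
        rw [Measure.prod_restrict]
        exact ae_restrict_of_ae h3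
      exact h1.mul_bdd (c := M) ((hum k).comp_measurable
        (measurable_fst.sub measurable_snd)).aestronglyMeasurable h2
    have hs : ∫ w in B, ∫ x in (Ω : Set (E N)), g k x * u k (x - w) =
        ∫ x in (Ω : Set (E N)), g k x * a k x := by
      rw [← integral_integral_swap hi1]
      simp only [integral_const_mul, a]
    have hsub : ∀ w ∈ B, (∫ x in (Ω : Set (E N)), g k x * u k x) -
        (∫ x in (Ω : Set (E N)), g k x * u k (x - w)) ≤ C * (M * ε) := by
      intro w hw
      have hwε : ‖w‖ ≤ ε := by simpa [B] using hw
      have h1 := (hgC k).abs_integral_translate_sub_le (hgi k) (hum k) hM (huM k) hK (huK k) hr hrK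
        (z := w) (hwε.trans (min_le_left _ _))
      have hi2 : Integrable (fun x => g k x * u k x) (leb Ω) :=
        (hgi k).mul_bdd (c := M) (hum k).aestronglyMeasurable (ae_restrict_of_ae (huM k))
      have hi3 : Integrable (fun x => g k x * u k (x - w)) (leb Ω) :=
        (hgi k).mul_bdd (c := M)
          ((hum k).comp_measurable (measurable_id.sub_const w)).aestronglyMeasurable
          (ae_restrict_of_ae
            ((measurePreserving_sub_right volume w).quasiMeasurePreserving.ae (huM k)))
      simp only [mul_sub] at h1
      rw [integral_sub hi3 hi2] at h1
      have h2 : C * (M * ‖w‖) ≤ C * (M * ε) := by gcongr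
      linarith [(abs_le.1 h1).1]
    have hi4 : Integrable (fun w => ∫ x in (Ω : Set (E N)), g k x * u k (x - w))
        (volume.restrict B) := hi1.integral_prod_right
    have h5 : ∫ w in B, ((∫ x in (Ω : Set (E N)), g k x * u k x) -
        ∫ x in (Ω : Set (E N)), g k x * u k (x - w)) ≤ ∫ w in B, C * (M * ε) :=
      setIntegral_mono_on ((integrable_const _).sub hi4) (integrable_const _)
        Metric.isClosed_closedBall.measurableSet hsub
    rw [integral_sub (integrable_const _) hi4, hs, setIntegral_const, setIntegral_const,
      ← husq, smul_eq_mul, smul_eq_mul] at h5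
    have h6 := le_abs_self (∫ x in (Ω : Set (E N)), g k x * a k x)
    linarith
  obtain ⟨n, hn⟩ := (Metric.tendsto_atTop'.1 hga) (v * (η / 2)) (by positivity)
  refine ⟨n, fun k hk => ?_⟩
  have h1 := hn k hk
  rw [Real.dist_0_eq_abs] at h1
  have h2 := hmain k
  rw [Real.dist_0_eq_abs, abs_of_nonneg (integral_nonneg fun x => sq_nonneg _)]
  have h3 : v * (∫ x in K, g k x ^ 2) < v * η := by nlinarith
  exact lt_of_mul_lt_mul_left h3 hv0.le

/-! ### Compactness in `L²(Ω)` under a bound on the total variation -/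

theorem memLp_divergence_testField {N : ℕ} {Ω : Opens (E N)} (Φ : 𝓓^{1}(Ω, E N)) :
    MemLp (divergence Φ) 2 (leb Ω) := by
  have hc : Continuous (divergence Φ) := by
    refine continuous_finsetSum _ fun i _ => ?_
    have h1 : Continuous (fderiv ℝ Φ) := Φ.contDiff.continuous_fderiv (by simp)
    exact (EuclideanSpace.proj i : E N →L[ℝ] ℝ).continuous.comp (h1.clm_apply continuous_const)
  refine hc.memLp_of_hasCompactSupport ?_
  exact (Φ.hasCompactSupport.fderiv ℝ).comp_left
    (g := fun L : E N →L[ℝ] E N => ∑ i, L (EuclideanSpace.single i 1) i) (by simp)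

theorem L2.integral_mul_eq_inner {N : ℕ} {Ω : Opens (E N)} (f : L2 Ω) {h : E N → ℝ}
    (hh : MemLp h 2 (leb Ω)) : ∫ x in (Ω : Set (E N)), f x * h x = inner ℝ f (hh.toLp h) := by
  rw [L2.inner_def]
  refine integral_congr_ae ?_
  filter_upwards [hh.coeFn_toLp] with x hx
  rw [hx, mul_comm]
  rfl

theorem VariationLE.of_tendsto_inner {N : ℕ} {Ω : Opens (E N)} {u : ℕ → L2 Ω} {a : L2 Ω} {C : ℝ}
    (hu : ∀ k, VariationLE Ω (u k) C)
    (h : ∀ w : L2 Ω, Tendsto (fun k => inner ℝ (u k) w) atTop (𝓝 (inner ℝ a w))) :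
    VariationLE Ω a C := by
  intro Φ hΦ
  have h1 := (h ((memLp_divergence_testField Φ).toLp _)).abs
  simp only [← L2.integral_mul_eq_inner] at h1
  exact le_of_tendsto h1 (Eventually.of_forall fun k => hu k Φ hΦ)

theorem VariationLE.sub {N : ℕ} {Ω : Opens (E N)} {a b : L2 Ω} {C D : ℝ}
    (ha : VariationLE Ω a C) (hb : VariationLE Ω b D) :
    VariationLE Ω (a - b : L2 Ω) (C + D) := by
  intro Φ hΦ
  have h1 := ha Φ hΦ
  have h2 := hb Φ hΦ
  rw [L2.integral_mul_eq_inner _ (memLp_divergence_testField Φ)] at h1 h2 ⊢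
  rw [inner_sub_left]
  exact (abs_sub _ _).trans (add_le_add h1 h2)

theorem L2.tendsto_setIntegral {N : ℕ} {Ω : Opens (E N)} [IsFiniteMeasure (leb Ω)]
    {u : ℕ → L2 Ω} {a : L2 Ω}
    (h : ∀ w : L2 Ω, Tendsto (fun k => inner ℝ (u k) w) atTop (𝓝 (inner ℝ a w)))
    {s : Set (E N)} (hs : MeasurableSet s) :
    Tendsto (fun k => ∫ x in s, u k x ∂(leb Ω)) atTop (𝓝 (∫ x in s, a x ∂(leb Ω))) := by
  have h1 := h (indicatorConstLp 2 hs (measure_ne_top (leb Ω) s) (1 : ℝ))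
  simp only [real_inner_comm (indicatorConstLp 2 hs (measure_ne_top (leb Ω) s) (1 : ℝ)),
    L2.inner_indicatorConstLp_one] at h1
  exact h1

theorem L2.integrable {N : ℕ} {Ω : Opens (E N)} [IsFiniteMeasure (leb Ω)] (u : L2 Ω) :
    Integrable u (leb Ω) :=
  (Lp.memLp u).integrable one_le_two

theorem L2.abs_le_of_tendsto_inner {N : ℕ} {Ω : Opens (E N)} [IsFiniteMeasure (leb Ω)]
    {u : ℕ → L2 Ω} {a : L2 Ω} {M : ℝ} (hu : ∀ k, ∀ᵐ x ∂(leb Ω), |u k x| ≤ M)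
    (h : ∀ w : L2 Ω, Tendsto (fun k => inner ℝ (u k) w) atTop (𝓝 (inner ℝ a w))) :
    ∀ᵐ x ∂(leb Ω), |a x| ≤ M := by
  have h1 : ⇑a ≤ᵐ[leb Ω] fun _ => M :=
    ae_le_of_forall_setIntegral_le (L2.integrable a) (integrable_const _) fun s hs _ =>
      le_of_tendsto (L2.tendsto_setIntegral h hs) (Eventually.of_forall fun k =>
        setIntegral_mono_ae (L2.integrable _).integrableOn (integrable_const _).integrableOn
          ((hu k).mono fun x hx => (abs_le.1 hx).2))
  have h2 : (fun _ => -M) ≤ᵐ[leb Ω] ⇑a :=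
    ae_le_of_forall_setIntegral_le (integrable_const _) (L2.integrable a) fun s hs _ =>
      ge_of_tendsto (L2.tendsto_setIntegral h hs) (Eventually.of_forall fun k =>
        setIntegral_mono_ae (integrable_const _).integrableOn (L2.integrable _).integrableOn
          ((hu k).mono fun x hx => (abs_le.1 hx).1))
  filter_upwards [h1, h2] with x hx1 hx2
  exact abs_le.2 ⟨hx2, hx1⟩

theorem L2.norm_sq_eq_integral {N : ℕ} {Ω : Opens (E N)} (g : L2 Ω) :
    ‖g‖ ^ 2 = ∫ x in (Ω : Set (E N)), g x ^ 2 := by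
  rw [← real_inner_self_eq_norm_sq, L2.inner_def]
  refine integral_congr_ae (Eventually.of_forall fun x => ?_)
  simp

theorem L2.integrable_sq {N : ℕ} {Ω : Opens (E N)} (g : L2 Ω) :
    Integrable (fun x => g x ^ 2) (leb Ω) :=
  (Lp.memLp g).integrable_sq

/-- A compact set exhausting `Ω` up to small measure reduces the claim to its local version; no
regularity of the boundary of `Ω` is needed, since the functions are bounded. -/
theorem tendsto_zero_of_variationLE {N : ℕ} {Ω : Opens (E N)}
    (hΩ : volume (Ω : Set (E N)) ≠ ∞) {g : ℕ → L2 Ω} {M C : ℝ} (hM : 0 < M) (hC : 0 ≤ C)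
    (hgM : ∀ k, ∀ᵐ x ∂(leb Ω), |g k x| ≤ M) (hgC : ∀ k, VariationLE Ω (g k) C)
    (hg0 : ∀ w : L2 Ω, Tendsto (fun k => inner ℝ (g k) w) atTop (𝓝 0)) :
    Tendsto g atTop (𝓝 0) := by
  have : IsFiniteMeasure (leb Ω) := ⟨by simpa using hΩ.lt_top⟩
  have hs0 : ∀ s : Set (E N), MeasurableSet s →
      Tendsto (fun k => ∫ x in s, g k x ∂(leb Ω)) atTop (𝓝 0) := by
    intro s hs
    have := L2.tendsto_setIntegral (u := g) (a := 0) (by simpa using hg0) hs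
    have h0 : ∫ x in s, (0 : L2 Ω) x ∂(leb Ω) = 0 := by
      rw [integral_congr_ae (ae_restrict_of_ae (Lp.coeFn_zero ℝ 2 (leb Ω)))]
      simp
    rwa [h0] at this
  have hsq : Tendsto (fun k => ‖g k‖ ^ 2) atTop (𝓝 0) := by
    rw [Metric.tendsto_atTop']
    intro η hη
    obtain ⟨K, hKΩ, hK, hKd⟩ := Ω.isOpen.measurableSet.exists_isCompact_sdiff_lt hΩ
      (ε := ENNReal.ofReal (η / (2 * M ^ 2))) (by simpa using by positivity)
    have hKd' : volume.real ((Ω : Set (E N)) \ K) < η / (2 * M ^ 2) :=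
      (ENNReal.lt_ofReal_iff_toReal_lt hKd.ne_top).1 hKd
    have hloc := tendsto_setIntegral_sq_of_variationLE hΩ (fun k => Lp.stronglyMeasurable (g k))
      hM hC hgM hgC hs0 hK hKΩ
    obtain ⟨n, hn⟩ := (Metric.tendsto_atTop'.1 hloc) (η / 2) (by positivity)
    refine ⟨n, fun k hk => ?_⟩
    have h1 := hn k hk
    rw [Real.dist_0_eq_abs, abs_of_nonneg (integral_nonneg fun x => sq_nonneg _)] at h1
    have hdiff := setIntegral_sdiff hK.measurableSet (L2.integrable_sq (g k)) hKΩ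
    have hrest : ∫ x in (Ω : Set (E N)) \ K, g k x ^ 2 ≤
        ∫ x in (Ω : Set (E N)) \ K, M ^ 2 := by
      refine setIntegral_mono_ae_restrict ((L2.integrable_sq (g k)).mono_measure
        (Measure.restrict_mono Set.sdiff_subset le_rfl)) (integrableOn_const hKd.ne_top) ?_
      filter_upwards [ae_restrict_of_ae_restrict_of_subset Set.sdiff_subset (hgM k)] with x hx
      exact sq_le_sq' (abs_le.1 hx).1 (abs_le.1 hx).2
    rw [setIntegral_const, smul_eq_mul] at hrest
    rw [lt_div_iff₀ (by positivity)] at hKd'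
    rw [Real.dist_0_eq_abs, abs_of_nonneg (sq_nonneg _), L2.norm_sq_eq_integral]
    linarith
  have h2 := hsq.sqrt
  simp only [Real.sqrt_sq (norm_nonneg _), Real.sqrt_zero] at h2
  exact tendsto_zero_iff_norm_tendsto_zero.2 h2

theorem exists_subseq_tendsto_of_variationLE {N : ℕ} {Ω : Opens (E N)}
    (hΩ : volume (Ω : Set (E N)) ≠ ∞) {u : ℕ → L2 Ω} {M C : ℝ} (hM : 0 < M) (hC : 0 ≤ C)
    (huM : ∀ k, ∀ᵐ x ∂(leb Ω), |u k x| ≤ M) (huC : ∀ k, VariationLE Ω (u k) C) :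
    ∃ (a : L2 Ω) (s : ℕ → ℕ), StrictMono s ∧ Tendsto (fun k => u (s k)) atTop (𝓝 a) := by
  have : IsFiniteMeasure (leb Ω) := ⟨by simpa using hΩ.lt_top⟩
  have hR : ∀ k, ‖u k‖ ≤ (leb Ω).real Set.univ ^ (2 : ℝ≥0∞).toReal⁻¹ * M := by
    intro k
    exact Lp.norm_le_of_ae_bound hM.le (huM k)
  have : Fact ((2 : ℝ≥0∞) ≠ ∞) := ⟨by simp⟩
  obtain ⟨a, s, hs, ha⟩ := exists_subseq_tendsto_inner hR
  refine ⟨a, s, hs, ?_⟩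
  have haM := L2.abs_le_of_tendsto_inner (fun k => huM (s k)) ha
  have haC := VariationLE.of_tendsto_inner (fun k => huC (s k)) ha
  have h0 : Tendsto (fun k => u (s k) - a) atTop (𝓝 0) := by
    refine tendsto_zero_of_variationLE hΩ (M := M + M) (C := C + C) (by positivity) (by positivity)
      (fun k => ?_) (fun k => (huC (s k)).sub haC) (fun w => ?_)
    · filter_upwards [huM (s k), haM, Lp.coeFn_sub (u (s k)) a] with x h1 h2 h3
      rw [h3]
      exact (abs_sub _ _).trans (add_le_add h1 h2)
    · simpa [inner_sub_left] using (ha w).sub_const (inner ℝ a w)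
  simpa using h0.add_const a

/-- Sequential compactness gives compactness, as `L²(Ω)` is metrizable; the set is closed even under
weak convergence. -/
theorem isCompact_setOf_variationLE {N : ℕ} {Ω : Opens (E N)}
    (hΩ : volume (Ω : Set (E N)) ≠ ∞) {M C : ℝ} (hM : 0 < M) (hC : 0 ≤ C) :
    IsCompact {u : L2 Ω | (∀ᵐ x ∂(leb Ω), |u x| ≤ M) ∧ VariationLE Ω u C} := by
  have : IsFiniteMeasure (leb Ω) := ⟨by simpa using hΩ.lt_top⟩
  refine isCompact_iff_isSeqCompact.2 fun u hu => ?_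
  obtain ⟨a, s, hs, ha⟩ := exists_subseq_tendsto_of_variationLE hΩ hM hC (fun k => (hu k).1)
    fun k => (hu k).2
  have hw : ∀ w : L2 Ω, Tendsto (fun k => inner ℝ (u (s k)) w) atTop (𝓝 (inner ℝ a w)) :=
    fun w => ha.inner tendsto_const_nhds
  exact ⟨a, ⟨L2.abs_le_of_tendsto_inner (fun k => (hu (s k)).1) hw,
    VariationLE.of_tendsto_inner (fun k => (hu (s k)).2) hw⟩, s, hs, ha⟩

/-! ### Compactness of the set of admissible controls -/

/-- The linear operator on `ℝ^N` with a given matrix, depending continuously on the matrix. -/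
noncomputable def matOp (N : ℕ) : Mat N →L[ℝ] E N →L[ℝ] E N :=
  LinearMap.toContinuousLinearMap
    ((LinearMap.toContinuousLinearMap (E := E N) (F' := E N)).toLinearMap ∘ₗ
      (Matrix.toEuclideanLin (𝕜 := ℝ) (m := Fin N) (n := Fin N)).toLinearMap)

theorem matForm_eq_inner {N : ℕ} (S : Mat N) (η ξ : E N) :
    matForm S η ξ = inner ℝ η (matOp N S ξ) := by
  change _ = inner ℝ η (Matrix.toEuclideanLin S ξ)
  rw [EuclideanSpace.inner_eq_star_dotProduct, dotProduct_comm]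
  simp [matForm]

theorem continuous_matForm {N : ℕ} (η ξ : E N) : Continuous fun S : Mat N => matForm S η ξ := by
  simp only [matForm_eq_inner]
  fun_prop

/-- The `(i, j)` entry of the symmetric part, as a linear functional of the matrix. -/
noncomputable def symEntry {N : ℕ} (i j : Fin N) : Mat N →L[ℝ] ℝ :=
  LinearMap.toContinuousLinearMap
    { toFun := fun S => symPart S i j
      map_add' := fun S T => by simp [symPart]; ring
      map_smul' := fun r S => by simp [symPart]; ring }

/-- The matrix with a single nonzero entry, as a linear function of that entry. -/
noncomputable def singleL {N : ℕ} (i j : Fin N) : ℝ →L[ℝ] Mat N :=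
  LinearMap.toContinuousLinearMap (Matrix.singleLinearMap ℝ i j)

theorem symPart_isSymm {N : ℕ} (S : Mat N) : (symPart S)ᵀ = symPart S := by
  simp [symPart, add_comm]

theorem continuous_symPart (N : ℕ) : Continuous (symPart (N := N)) :=
  continuous_pi fun i => continuous_pi fun j => (symEntry i j).continuous

theorem skewPart_add_sum_single {N : ℕ} (S : Mat N) :
    skewPartₗ N S + ∑ p : Fin N × Fin N, singleL p.1 p.2 (symEntry p.1 p.2 S) = S := by
  have h1 : ∑ p : Fin N × Fin N, singleL p.1 p.2 (symEntry p.1 p.2 S) = symPart S := by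
    rw [Fintype.sum_prod_type]
    exact (Matrix.matrix_eq_sum_single (symPart S)).symm
  rw [h1]
  simp only [skewPartₗ, LinearMap.coe_mk, AddHom.coe_mk, symPart]
  module

/-- The off-diagonal entries are bounded by polarization with the vectors `e_i + e_j`. -/
theorem norm_le_of_form_bounds {N : ℕ} {S : Mat N} {α β : ℝ} (hα : 0 ≤ α) (hβ : 0 ≤ β)
    (hS : Sᵀ = S)
    (h : ∀ ξ : E N, α * ‖ξ‖ ^ 2 ≤ matForm S ξ ξ ∧ matForm S ξ ξ ≤ β * ‖ξ‖ ^ 2) :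
    ‖S‖ ≤ 2 * β := by
  have hnn : ∀ ξ : E N, 0 ≤ matForm S ξ ξ := fun ξ =>
    (by positivity : 0 ≤ α * ‖ξ‖ ^ 2).trans (h ξ).1
  have he : ∀ i j : Fin N,
      matForm S (EuclideanSpace.single i 1) (EuclideanSpace.single j 1) = S i j := by
    intro i j
    simp [matForm]
  refine (Matrix.norm_le_iff (by positivity)).2 fun i j => ?_
  have hsum : matForm S (EuclideanSpace.single i 1 + EuclideanSpace.single j 1)
      (EuclideanSpace.single i 1 + EuclideanSpace.single j 1) = S i i + 2 * S i j + S j j := by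
    have hji : S j i = S i j := congrFun (congrFun hS i) j
    have hadd : ∀ a b : E N, matForm S (a + b) (a + b) =
        matForm S a a + matForm S a b + matForm S b a + matForm S b b := by
      intro a b
      simp only [matForm_eq_inner, map_add, inner_add_left, inner_add_right]
      ring
    rw [hadd, he, he, he, he, hji]
    ring
  have hd : ∀ i : Fin N, 0 ≤ S i i ∧ S i i ≤ β := by
    intro i
    have h1 := hnn (EuclideanSpace.single i 1)
    have h2 := (h (EuclideanSpace.single i 1)).2
    rw [he] at h1 h2
    simpa using And.intro h1 h2
  have hn : ‖(EuclideanSpace.single i 1 + EuclideanSpace.single j 1 : E N)‖ ≤ 2 :=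
    (norm_add_le _ _).trans (by simp; norm_num)
  have h1 := hnn (EuclideanSpace.single i 1 + EuclideanSpace.single j 1)
  have h2 := (h (EuclideanSpace.single i 1 + EuclideanSpace.single j 1)).2
  have h3 : β * ‖(EuclideanSpace.single i 1 + EuclideanSpace.single j 1 : E N)‖ ^ 2 ≤ β * 2 ^ 2 := by
    gcongr
  rw [hsum] at h1 h2
  rw [Real.norm_eq_abs, abs_le]
  constructor <;> linarith [(hd i).1, (hd i).2, (hd j).1, (hd j).2]

theorem skewField_coeFn {N : ℕ} {Ω : Opens (E N)} (A : L2Mat Ω) :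
    ∀ᵐ x ∂(leb Ω), skewField A x = skewPartₗ N (A x) :=
  ContinuousLinearMap.coeFn_compLp _ A

theorem continuous_skewField {N : ℕ} {Ω : Opens (E N)} :
    Continuous (skewField : L2Mat Ω → L2Mat Ω) :=
  (ContinuousLinearMap.compLpL 2 (leb Ω)
    (LinearMap.toContinuousLinearMap (skewPartₗ N))).continuous

theorem ae_norm_le_of_memMαβ {N : ℕ} {Ω : Opens (E N)} {α β : ℝ} {S : E N → Mat N}
    (hS : MemMαβ Ω α β S) (hα : 0 ≤ α) (hβ : 0 ≤ β) : ∀ᵐ x ∂(leb Ω), ‖S x‖ ≤ 2 * β := by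
  filter_upwards [hS.2.1, hS.2.2] with x h1 h2
  exact norm_le_of_form_bounds hα hβ h1 h2

theorem VariationLE.congr_ae {N : ℕ} {Ω : Opens (E N)} {g h : E N → ℝ} {C : ℝ}
    (hg : VariationLE Ω g C) (hgh : ∀ᵐ x ∂(leb Ω), g x = h x) : VariationLE Ω h C := by
  intro Φ hΦ
  have : ∫ x in (Ω : Set (E N)), h x * divergence Φ x =
      ∫ x in (Ω : Set (E N)), g x * divergence Φ x :=
    integral_congr_ae (hgh.mono fun x hx => by simp [hx])
  rw [this]
  exact hg Φ hΦ

theorem L2Mat.exists_subseq_ae_tendsto {N : ℕ} {Ω : Opens (E N)} {A : ℕ → L2Mat Ω} {A₀ : L2Mat Ω}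
    (hA : Tendsto A atTop (𝓝 A₀)) : ∃ s : ℕ → ℕ, StrictMono s ∧
      ∀ᵐ x ∂(leb Ω), Tendsto (fun k => A (s k) x) atTop (𝓝 (A₀ x)) :=
  (tendstoInMeasure_of_tendsto_Lp hA).exists_seq_tendsto_ae

theorem isClosed_admissibleControls {N : ℕ} {Ω : Opens (E N)} {α β c : ℝ} (hα : 0 ≤ α)
    (hβ : 0 ≤ β) (hc : 0 ≤ c) {Astar : L2Mat Ω} {Q : Set (L2Mat Ω)} (hQ : IsClosed Q) :
    IsClosed (admissibleControls Ω α β c Astar Q) := by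
  refine IsSeqClosed.isClosed fun A A₀ hA hlim => ?_
  obtain ⟨s, -, hs⟩ := L2Mat.exists_subseq_ae_tendsto hlim
  have hsym : ∀ᵐ x ∂(leb Ω), Tendsto (fun k => symField (A (s k)) x) atTop (𝓝 (symField A₀ x)) :=
    hs.mono fun x hx => ((continuous_symPart N).tendsto _).comp hx
  have hform : ∀ᵐ x ∂(leb Ω), ∀ ξ : E N, α * ‖ξ‖ ^ 2 ≤ matForm (symField A₀ x) ξ ξ ∧
      matForm (symField A₀ x) ξ ξ ≤ β * ‖ξ‖ ^ 2 := by
    filter_upwards [hsym, ae_all_iff.2 fun k => (hA (s k)).2.1.2.2] with x hx hk ξ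
    have h1 : Tendsto (fun k => matForm (symField (A (s k)) x) ξ ξ) atTop
        (𝓝 (matForm (symField A₀ x) ξ ξ)) :=
      ((continuous_matForm ξ ξ).tendsto _).comp hx
    exact ⟨ge_of_tendsto' h1 fun k => (hk k ξ).1, le_of_tendsto' h1 fun k => (hk k ξ).2⟩
  refine ⟨fun i j hij => ?_, ⟨?_, ?_, hform⟩, ?_, ?_⟩
  · rw [totalVariation_le_iff hc]
    have hcoe : ∀ B : L2Mat Ω, ∀ᵐ x ∂(leb Ω),
        (symEntry i j).compLp B x = symField B x i j := fun B =>
      ContinuousLinearMap.coeFn_compLp _ B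
    refine VariationLE.congr_ae ?_ (hcoe A₀)
    refine VariationLE.of_tendsto_inner (u := fun k => (symEntry i j).compLp (A k))
      (fun k => ?_) (fun w => ?_)
    · refine VariationLE.congr_ae ((totalVariation_le_iff hc).1 ((hA k).1 i j hij)) ?_
      filter_upwards [hcoe (A k)] with x hx using hx.symm
    · exact ((((ContinuousLinearMap.compLpL 2 (leb Ω) (symEntry i j)).continuous.tendsto _).comp
        hlim).inner tendsto_const_nhds)
  · refine memLp_top_of_bound ((continuous_symPart N).comp_aestronglyMeasurable
      (Lp.aestronglyMeasurable A₀)) (2 * β) ?_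
    filter_upwards [hform] with x hx
    exact norm_le_of_form_bounds hα hβ (symPart_isSymm _) hx
  · exact Eventually.of_forall fun x => symPart_isSymm _
  · filter_upwards [hs, skewField_coeFn A₀, ae_all_iff.2 fun k => skewField_coeFn (A (s k)),
      ae_all_iff.2 fun k => (hA (s k)).2.2.1] with x h1 h2 h3 h4 i j hij
    rw [h2]
    have h5 : Tendsto (fun k => skewPartₗ N (A (s k) x)) atTop (𝓝 (skewPartₗ N (A₀ x))) :=
      ((LinearMap.toContinuousLinearMap (skewPartₗ N)).continuous.tendsto _).comp h1
    have h6 := (tendsto_pi_nhds.1 (tendsto_pi_nhds.1 h5 i) j).abs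
    refine le_of_tendsto' h6 fun k => ?_
    rw [← h3 k]
    exact h4 k i j hij
  · exact hQ.mem_of_tendsto ((continuous_skewField.tendsto _).comp hlim)
      (Eventually.of_forall fun k => (hA k).2.2.2)

theorem isCompact_admissibleControls {N : ℕ} {Ω : Opens (E N)}
    (hΩ : volume (Ω : Set (E N)) ≠ ∞) {α β c : ℝ} (hα : 0 ≤ α) (hβ : 0 < β) (hc : 0 ≤ c)
    {Astar : L2Mat Ω} {Q : Set (L2Mat Ω)} (hQ : IsCompact Q) :
    IsCompact (admissibleControls Ω α β c Astar Q) := by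
  -- A control is recovered continuously from its skew part and the entries of its symmetric part.
  let T : L2Mat Ω × (Fin N × Fin N → L2 Ω) → L2Mat Ω := fun q =>
    q.1 + ∑ p : Fin N × Fin N, (singleL p.1 p.2).compLpL 2 (leb Ω) (q.2 p)
  have hT : Continuous T := by fun_prop
  have hK := (hQ.prod (isCompact_univ_pi fun _ : Fin N × Fin N =>
    isCompact_setOf_variationLE (Ω := Ω) hΩ (M := 2 * β) (by positivity) hc)).image hT
  refine hK.of_isClosed_subset (isClosed_admissibleControls hα hβ.le hc hQ.isClosed) ?_
  intro A hA
  refine ⟨(skewField A, fun p => (symEntry p.1 p.2).compLp A), ⟨hA.2.2.2, fun p _ => ⟨?_, ?_⟩⟩, ?_⟩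
  · filter_upwards [ae_norm_le_of_memMαβ hA.2.1 hα hβ.le, (symEntry p.1 p.2).coeFn_compLp A]
      with x h1 h2
    rw [h2]
    exact (Matrix.norm_entry_le_entrywise_sup_norm (symField A x)).trans h1
  · have h1 : VariationLE Ω (fun x => symField A x p.1 p.2) c := by
      rcases le_total p.1 p.2 with h | h
      · exact (totalVariation_le_iff hc).1 (hA.1 _ _ h)
      · have h2 : ∀ x, symField A x p.1 p.2 = symField A x p.2 p.1 := fun x =>
          congrFun (congrFun (symPart_isSymm (A x)) p.2) p.1
        simp only [h2]
        exact (totalVariation_le_iff hc).1 (hA.1 _ _ h)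
    refine h1.congr_ae ?_
    filter_upwards [(symEntry p.1 p.2).coeFn_compLp A] with x hx using hx.symm
  · refine Lp.ext ?_
    have h1 : ∀ᵐ x ∂(leb Ω), ∀ p : Fin N × Fin N,
        (singleL p.1 p.2).compLpL 2 (leb Ω) ((symEntry p.1 p.2).compLp A) x =
          singleL p.1 p.2 (symEntry p.1 p.2 (A x)) := by
      refine ae_all_iff.2 fun p => ?_
      filter_upwards [(singleL p.1 p.2).coeFn_compLpL ((symEntry p.1 p.2).compLp A),
        (symEntry p.1 p.2).coeFn_compLp A] with x hx1 hx2
      rw [hx1, hx2]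
      rfl
    filter_upwards [h1, skewField_coeFn A, Lp.coeFn_add (skewField A)
      (∑ p : Fin N × Fin N, (singleL p.1 p.2).compLpL 2 (leb Ω) ((symEntry p.1 p.2).compLp A)),
      Lp.coeFn_finsetSum Finset.univ fun p : Fin N × Fin N =>
        (singleL p.1 p.2).compLpL 2 (leb Ω) ((symEntry p.1 p.2).compLp A)] with x h1 h2 h3 h4
    rw [h3, Pi.add_apply, h4, h2, Finset.sum_apply]
    simp only [h1]
    exact skewPart_add_sum_single (A x)

/-! ### The state equation -/

/-- `y ↦ ∇y` as a bounded linear map `H^1_0(Ω) → L²(Ω; ℝ^N)`. -/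
noncomputable def gradL {N : ℕ} (Ω : Opens (E N)) : H10 Ω →L[ℝ] L2Vec Ω :=
  (WithLp.sndL 2 ℝ (L2 Ω) (L2Vec Ω)).comp (H10 Ω).subtypeL

/-- The embedding `H^1_0(Ω) → L²(Ω)`. -/
noncomputable def fnL {N : ℕ} (Ω : Opens (E N)) : H10 Ω →L[ℝ] L2 Ω :=
  (WithLp.fstL 2 ℝ (L2 Ω) (L2Vec Ω)).comp (H10 Ω).subtypeL

theorem gradL_apply {N : ℕ} {Ω : Opens (E N)} (y : H10 Ω) : gradL Ω y = gradOf y := rfl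

theorem norm_sq_H10 {N : ℕ} {Ω : Opens (E N)} (y : H10 Ω) :
    ‖y‖ ^ 2 = ‖fnOf y‖ ^ 2 + ‖gradOf y‖ ^ 2 :=
  WithLp.prod_norm_sq_eq_of_L2 (y : WithLp 2 (L2 Ω × L2Vec Ω))

theorem gradOf_testH10 {N : ℕ} {Ω : Opens (E N)} (φ : 𝓓(Ω, ℝ)) :
    gradOf (testH10 φ) = (memLp_gradient_testFunction φ).toLp _ := rfl

theorem testH10_sub {N : ℕ} {Ω : Opens (E N)} (φ ψ : 𝓓(Ω, ℝ)) :
    testH10 (φ - ψ) = testH10 φ - testH10 ψ :=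
  Subtype.ext (map_sub (testGraph Ω) φ ψ)

theorem denseRange_testH10 {N : ℕ} {Ω : Opens (E N)} : DenseRange (testH10 (Ω := Ω)) := by
  intro y
  rw [closure_subtype, ← Set.range_comp]
  exact y.2

theorem neBot_comap_testH10 {N : ℕ} {Ω : Opens (E N)} (y : H10 Ω) :
    (comap (testH10 (Ω := Ω)) (𝓝 y)).NeBot :=
  comap_neBot fun s hs => by
    obtain ⟨_, hφ, φ, rfl⟩ := mem_closure_iff_nhds.1 (denseRange_testH10 y) s hs
    exact ⟨φ, hφ⟩

theorem norm_sq_L2Vec {N : ℕ} {Ω : Opens (E N)} (v : L2Vec Ω) :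
    ‖v‖ ^ 2 = ∫ x in (Ω : Set (E N)), ‖v x‖ ^ 2 := by
  rw [← real_inner_self_eq_norm_sq, L2.inner_def]
  simp only [real_inner_self_eq_norm_sq]

theorem sqrt_integral_gradient_sq {N : ℕ} {Ω : Opens (E N)} (φ : 𝓓(Ω, ℝ)) :
    Real.sqrt (∫ x in (Ω : Set (E N)), ‖gradient φ x‖ ^ 2) = ‖gradOf (testH10 φ)‖ := by
  rw [← Real.sqrt_sq (norm_nonneg (gradOf (testH10 φ))), norm_sq_L2Vec, gradOf_testH10]
  congr 1
  refine integral_congr_ae ?_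
  filter_upwards [(memLp_gradient_testFunction φ).coeFn_toLp] with x hx
  rw [hx]

theorem exists_norm_apply_le {N : ℕ} (L : Mat N →L[ℝ] E N →L[ℝ] E N) :
    ∃ C : ℝ, 0 < C ∧ ∀ S ξ, ‖L S ξ‖ ≤ C * ‖S‖ * ‖ξ‖ := by
  obtain ⟨C, hC, h⟩ := SemilinearMapClass.bound_of_continuous L.toLinearMap L.continuous
  exact ⟨C, hC, fun S ξ => ((L S).le_opNorm ξ).trans
    (mul_le_mul_of_nonneg_right (h S) (norm_nonneg _))⟩

theorem aestronglyMeasurable_apply {N : ℕ} {Ω : Opens (E N)} (L : Mat N →L[ℝ] E N →L[ℝ] E N)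
    {S : E N → Mat N} (hS : AEStronglyMeasurable S (leb Ω)) {v : E N → E N}
    (hv : AEStronglyMeasurable v (leb Ω)) :
    AEStronglyMeasurable (fun x => L (S x) (v x)) (leb Ω) :=
  isBoundedBilinearMap_apply.continuous.comp_aestronglyMeasurable
    ((L.continuous.comp_aestronglyMeasurable hS).prodMk hv)

/-- The gradient of a test function is bounded, so a matrix field in `L²` maps it to `L²`. -/
theorem memLp_apply_gradient {N : ℕ} {Ω : Opens (E N)} (L : Mat N →L[ℝ] E N →L[ℝ] E N)
    (A : L2Mat Ω) (φ : 𝓓(Ω, ℝ)) : MemLp (fun x => L (A x) (gradient φ x)) 2 (leb Ω) := by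
  obtain ⟨B, hB⟩ := (hasCompactSupport_gradient_testFunction φ).exists_bound_of_continuous
    (continuous_gradient_testFunction φ)
  obtain ⟨C, hC0, hC⟩ := exists_norm_apply_le L
  refine MemLp.of_le_mul (c := C * B) (Lp.memLp A) ?_ (Eventually.of_forall fun x => ?_)
  · exact aestronglyMeasurable_apply L (Lp.aestronglyMeasurable A)
      (continuous_gradient_testFunction φ).aestronglyMeasurable
  · calc ‖L (A x) (gradient φ x)‖ ≤ C * ‖A x‖ * ‖gradient φ x‖ := hC _ _
      _ ≤ C * ‖A x‖ * B := by gcongr; exact hB x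
      _ = C * B * ‖A x‖ := by ring

/-- The `L²` field `x ↦ L(A(x)) ∇φ(x)`, for a matrix-linear operator `L`. -/
noncomputable def applyGradient {N : ℕ} {Ω : Opens (E N)} (L : Mat N →L[ℝ] E N →L[ℝ] E N)
    (A : L2Mat Ω) (φ : 𝓓(Ω, ℝ)) : L2Vec Ω :=
  (memLp_apply_gradient L A φ).toLp _

theorem continuous_applyGradient {N : ℕ} {Ω : Opens (E N)} (L : Mat N →L[ℝ] E N →L[ℝ] E N)
    (φ : 𝓓(Ω, ℝ)) : Continuous fun A : L2Mat Ω => applyGradient L A φ := by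
  obtain ⟨B, hB⟩ := (hasCompactSupport_gradient_testFunction φ).exists_bound_of_continuous
    (continuous_gradient_testFunction φ)
  have hB0 : 0 ≤ B := (norm_nonneg _).trans (hB 0)
  obtain ⟨C, hC0, hC⟩ := exists_norm_apply_le L
  refine (LipschitzWith.of_dist_le_mul (K := ⟨C * B, by positivity⟩) fun A A' => ?_).continuous
  rw [dist_eq_norm, dist_eq_norm]
  refine Lp.norm_le_mul_norm_of_ae_le_mul ?_
  filter_upwards [(memLp_apply_gradient L A φ).coeFn_toLp,
    (memLp_apply_gradient L A' φ).coeFn_toLp, Lp.coeFn_sub A A',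
    Lp.coeFn_sub (applyGradient L A φ) (applyGradient L A' φ)] with x h1 h2 h3 h4
  rw [h4, h3, Pi.sub_apply, Pi.sub_apply, applyGradient, applyGradient, h1, h2,
    ← sub_apply, ← map_sub]
  calc ‖L (A x - A' x) (gradient φ x)‖ ≤ C * ‖A x - A' x‖ * ‖gradient φ x‖ := hC _ _
    _ ≤ C * ‖A x - A' x‖ * B := by gcongr; exact hB x
    _ = C * B * ‖A x - A' x‖ := by ring

theorem applyGradient_sub {N : ℕ} {Ω : Opens (E N)} (L : Mat N →L[ℝ] E N →L[ℝ] E N)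
    (A : L2Mat Ω) (φ ψ : 𝓓(Ω, ℝ)) :
    applyGradient L A (φ - ψ) = applyGradient L A φ - applyGradient L A ψ := by
  have hgr : ∀ x, gradient (φ - ψ : 𝓓(Ω, ℝ)) x = gradient φ x - gradient ψ x := by
    intro x
    have : fderiv ℝ (φ - ψ : 𝓓(Ω, ℝ)) x = fderiv ℝ φ x - fderiv ℝ ψ x :=
      fderiv_sub (differentiable_testFunction φ x) (differentiable_testFunction ψ x)
    change (InnerProductSpace.toDual ℝ (E N)).symm _ = _
    rw [this, map_sub]
    rfl
  refine Lp.ext ?_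
  filter_upwards [(memLp_apply_gradient L A φ).coeFn_toLp,
    (memLp_apply_gradient L A ψ).coeFn_toLp, (memLp_apply_gradient L A (φ - ψ)).coeFn_toLp,
    Lp.coeFn_sub (applyGradient L A φ) (applyGradient L A ψ)] with x h1 h2 h3 h4
  rw [h4, Pi.sub_apply, applyGradient, applyGradient, applyGradient, h1, h2, h3, hgr, map_sub]

/-- `S ↦ (P S)ᵗ` as an operator, for a linear endomorphism `P` of the matrices. -/
noncomputable def transposeOp {N : ℕ} (P : Mat N →ₗ[ℝ] Mat N) : Mat N →L[ℝ] E N →L[ℝ] E N :=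
  (matOp N).comp (LinearMap.toContinuousLinearMap
    ((Matrix.transposeLinearEquiv (Fin N) (Fin N) ℝ ℝ).toLinearMap ∘ₗ P))

theorem matForm_eq_inner_transposeOp {N : ℕ} (P : Mat N →ₗ[ℝ] Mat N) (S : Mat N) (η ξ : E N) :
    matForm (P S) η ξ = inner ℝ ξ (transposeOp P S η) := by
  change _ = inner ℝ ξ (matOp N (P S)ᵀ η)
  rw [← matForm_eq_inner]
  simp only [matForm]
  rw [Matrix.mulVec_transpose, Matrix.dotProduct_mulVec, dotProduct_comm]

/-- The symmetric part as a linear map. -/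
noncomputable def symPartₗ (N : ℕ) : Mat N →ₗ[ℝ] Mat N where
  toFun := symPart
  map_add' S T := by simp only [symPart, Matrix.transpose_add]; module
  map_smul' r S := by simp only [symPart, Matrix.transpose_smul, RingHom.id_apply]; module

theorem skewFormTest_eq_inner {N : ℕ} {Ω : Opens (E N)} (A : L2Mat Ω) (y : H10 Ω) (φ : 𝓓(Ω, ℝ)) :
    skewFormTest A y φ = inner ℝ (gradOf y) (applyGradient (transposeOp (skewPartₗ N)) A φ) := by
  rw [L2.inner_def]
  refine integral_congr_ae ?_
  filter_upwards [skewField_coeFn A,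
    (memLp_apply_gradient (transposeOp (skewPartₗ N)) A φ).coeFn_toLp] with x h1 h2
  rw [applyGradient, h2, h1, matForm_eq_inner_transposeOp]

theorem integral_symForm_test_eq_inner {N : ℕ} {Ω : Opens (E N)} (A : L2Mat Ω) (y : H10 Ω)
    (φ : 𝓓(Ω, ℝ)) :
    ∫ x in (Ω : Set (E N)), matForm (symField A x) (gradOf (testH10 φ) x) (gradOf y x) =
      inner ℝ (gradOf y) (applyGradient (transposeOp (symPartₗ N)) A φ) := by
  rw [L2.inner_def, gradOf_testH10]
  refine integral_congr_ae ?_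
  filter_upwards [(memLp_gradient_testFunction φ).coeFn_toLp,
    (memLp_apply_gradient (transposeOp (symPartₗ N)) A φ).coeFn_toLp] with x h1 h2
  rw [applyGradient, h2, h1]
  exact matForm_eq_inner_transposeOp (symPartₗ N) (A x) _ _

theorem memLp_matOp_apply {N : ℕ} {Ω : Opens (E N)} {S : E N → Mat N}
    (hS : MemLp S ∞ (leb Ω)) (v : L2Vec Ω) : MemLp (fun x => matOp N (S x) (v x)) 2 (leb Ω) := by
  obtain ⟨C, -, hC⟩ := exists_norm_apply_le (matOp N)
  have h : MemLp (fun x => ‖S x‖ * ‖v x‖) 2 (leb Ω) := (Lp.memLp v).norm.mul hS.norm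
  refine h.of_le_mul (c := C)
    (aestronglyMeasurable_apply _ hS.aestronglyMeasurable (Lp.aestronglyMeasurable v))
    (Eventually.of_forall fun x => ?_)
  rw [Real.norm_of_nonneg (by positivity), ← mul_assoc]
  exact hC _ _

/-- The flux `S ∇y`, for a bounded matrix field `S`. -/
noncomputable def flux {N : ℕ} {Ω : Opens (E N)} {S : E N → Mat N} (hS : MemLp S ∞ (leb Ω))
    (v : L2Vec Ω) : L2Vec Ω :=
  (memLp_matOp_apply hS v).toLp _

theorem integral_matForm_eq_inner_flux {N : ℕ} {Ω : Opens (E N)} {S : E N → Mat N}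
    (hS : MemLp S ∞ (leb Ω)) (v w : L2Vec Ω) :
    ∫ x in (Ω : Set (E N)), matForm (S x) (w x) (v x) = inner ℝ w (flux hS v) := by
  rw [L2.inner_def]
  refine integral_congr_ae ?_
  filter_upwards [(memLp_matOp_apply hS v).coeFn_toLp] with x hx
  rw [flux, hx, matForm_eq_inner]

/-- The extension by continuity is determined by its values on test functions. -/
theorem skewForm_eq_of_forall_test {N : ℕ} {Ω : Opens (E N)} {A : L2Mat Ω} {y : H10 Ω}
    {G : H10 Ω → ℝ} (hG : Continuous G) (h : ∀ φ, skewFormTest A y φ = G (testH10 φ))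
    (φ : H10 Ω) : skewForm A y φ = G φ := by
  have hne := neBot_comap_testH10 φ
  refine Tendsto.limUnder_eq ?_
  have : skewFormTest A y = G ∘ testH10 := funext h
  rw [this]
  exact (hG.tendsto φ).comp tendsto_comap

theorem skewForm_testH10 {N : ℕ} {Ω : Opens (E N)} {A : L2Mat Ω} {y : H10 Ω}
    (hy : y ∈ domain A) (φ : 𝓓(Ω, ℝ)) : skewForm A y (testH10 φ) = skewFormTest A y φ := by
  have hne := neBot_comap_testH10 (testH10 φ)
  refine Tendsto.limUnder_eq ?_
  obtain ⟨k, hk⟩ := hy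
  rw [tendsto_iff_norm_sub_tendsto_zero]
  have h1 : Tendsto (fun ψ : 𝓓(Ω, ℝ) => k * ‖gradOf (testH10 ψ - testH10 φ)‖)
      (comap testH10 (𝓝 (testH10 φ))) (𝓝 0) := by
    have hc : Continuous fun u : H10 Ω => k * ‖gradL Ω (u - testH10 φ)‖ := by fun_prop
    have := (hc.tendsto (testH10 φ)).comp (tendsto_comap (f := testH10 (Ω := Ω)))
    rw [sub_self, map_zero, norm_zero, mul_zero] at this
    exact this
  refine squeeze_zero (fun _ => norm_nonneg _) (fun ψ => ?_) h1
  have h2 := hk (ψ - φ)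
  rw [sqrt_integral_gradient_sq, testH10_sub, skewFormTest_eq_inner, applyGradient_sub,
    inner_sub_right, ← skewFormTest_eq_inner, ← skewFormTest_eq_inner] at h2
  exact h2

theorem flux_sub {N : ℕ} {Ω : Opens (E N)} {S : E N → Mat N} (hS : MemLp S ∞ (leb Ω))
    (v w : L2Vec Ω) : flux hS (v - w) = flux hS v - flux hS w := by
  refine Lp.ext ?_
  filter_upwards [(memLp_matOp_apply hS v).coeFn_toLp, (memLp_matOp_apply hS w).coeFn_toLp,
    (memLp_matOp_apply hS (v - w)).coeFn_toLp, Lp.coeFn_sub (flux hS v) (flux hS w),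
    Lp.coeFn_sub v w] with x h1 h2 h3 h4 h5
  rw [h4, Pi.sub_apply, flux, flux, flux, h1, h2, h3, h5, Pi.sub_apply, map_sub]

theorem inner_flux_comm {N : ℕ} {Ω : Opens (E N)} {S : E N → Mat N} (hS : MemLp S ∞ (leb Ω))
    (hsym : ∀ᵐ x ∂(leb Ω), (S x)ᵀ = S x) (v w : L2Vec Ω) :
    inner ℝ v (flux hS w) = inner ℝ w (flux hS v) := by
  rw [← integral_matForm_eq_inner_flux, ← integral_matForm_eq_inner_flux]
  refine integral_congr_ae ?_
  filter_upwards [hsym] with x hx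
  rw [matForm, matForm, Matrix.dotProduct_mulVec, ← Matrix.mulVec_transpose, hx, dotProduct_comm]

theorem mul_norm_sq_le_inner_flux {N : ℕ} {Ω : Opens (E N)} {α β : ℝ} {S : E N → Mat N}
    (hS : MemMαβ Ω α β S) (v : L2Vec Ω) : α * ‖v‖ ^ 2 ≤ inner ℝ v (flux hS.1 v) := by
  rw [norm_sq_L2Vec, ← integral_const_mul, L2.inner_def]
  refine integral_mono_ae ((Lp.memLp v).integrable_norm_pow (by simp) |>.const_mul α)
    (L2.integrable_inner _ _) ?_
  filter_upwards [hS.2.2, (memLp_matOp_apply hS.1 v).coeFn_toLp] with x h1 h2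
  rw [flux, h2, ← matForm_eq_inner]
  exact (h1 (v x)).1

theorem tendsto_flux {N : ℕ} {Ω : Opens (E N)} {S : ℕ → E N → Mat N} {S₀ : E N → Mat N}
    (hS : ∀ k, MemLp (S k) ∞ (leb Ω)) (hS₀ : MemLp S₀ ∞ (leb Ω)) {C : ℝ}
    (hC : ∀ k, ∀ᵐ x ∂(leb Ω), ‖S k x‖ ≤ C)
    (hlim : ∀ᵐ x ∂(leb Ω), Tendsto (fun k => S k x) atTop (𝓝 (S₀ x))) (v : L2Vec Ω) :
    Tendsto (fun k => flux (hS k) v) atTop (𝓝 (flux hS₀ v)) := by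
  obtain ⟨D, hD0, hD⟩ := exists_norm_apply_le (matOp N)
  have hsub : ∀ k, ∀ᵐ x ∂(leb Ω),
      (flux (hS k) v - flux hS₀ v) x = matOp N (S k x - S₀ x) (v x) := by
    intro k
    filter_upwards [(memLp_matOp_apply (hS k) v).coeFn_toLp,
      (memLp_matOp_apply hS₀ v).coeFn_toLp, Lp.coeFn_sub (flux (hS k) v) (flux hS₀ v)]
      with x h1 h2 h3
    rw [h3, Pi.sub_apply, flux, flux, h1, h2, map_sub, sub_apply]
  have hlim0 : Tendsto (fun k => ‖flux (hS k) v - flux hS₀ v‖ ^ 2) atTop (𝓝 0) := by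
    simp only [norm_sq_L2Vec]
    have h0 : ∫ x in (Ω : Set (E N)), (0 : ℝ) = 0 := by simp
    rw [← h0]
    refine tendsto_integral_of_dominated_convergence
      (fun x => (D * (C + C)) ^ 2 * ‖v x‖ ^ 2) (fun k => ?_)
      ((Lp.memLp v).integrable_norm_pow (by simp) |>.const_mul _) (fun k => ?_) ?_
    · exact (Lp.aestronglyMeasurable _).norm.pow 2
    · filter_upwards [hsub k, ae_all_iff.2 hC, hlim] with x h1 h2 h3
      have hS₀C : ‖S₀ x‖ ≤ C := le_of_tendsto' h3.norm h2
      have hCC : ‖S k x - S₀ x‖ ≤ C + C := (norm_sub_le _ _).trans (add_le_add (h2 k) hS₀C)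
      rw [h1, Real.norm_of_nonneg (sq_nonneg _), ← mul_pow]
      refine pow_le_pow_left₀ (norm_nonneg _) ((hD _ _).trans ?_) 2
      gcongr
    · filter_upwards [ae_all_iff.2 hsub, hlim] with x h1 h3
      simp only [h1]
      have h4 : Tendsto (fun k => D * ‖S k x - S₀ x‖ * ‖v x‖) atTop (𝓝 0) := by
        simpa using ((tendsto_iff_norm_sub_tendsto_zero.1 h3).const_mul D).mul_const ‖v x‖
      have h5 := squeeze_zero (fun k => norm_nonneg (matOp N (S k x - S₀ x) (v x)))
        (fun k => hD _ _) h4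
      simpa using h5.pow 2
  have h2 := hlim0.sqrt
  simp only [Real.sqrt_sq (norm_nonneg _), Real.sqrt_zero] at h2
  exact tendsto_iff_norm_sub_tendsto_zero.2 h2

theorem eq_on_test_of_mem_admissiblePairs {N : ℕ} {Ω : Opens (E N)} {α β c : ℝ}
    {Astar : L2Mat Ω} {Q : Set (L2Mat Ω)} {f : Hneg1 Ω} {A : L2Mat Ω} {y : H10 Ω}
    (h : (A, y) ∈ admissiblePairs Ω α β c Astar Q f) (φ : 𝓓(Ω, ℝ)) :
    (∫ x in (Ω : Set (E N)), matForm (symField A x) (gradOf (testH10 φ) x) (gradOf y x))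
      + skewFormTest A y φ = f (testH10 φ) := by
  rw [← skewForm_testH10 h.2.1]
  exact h.2.2 (testH10 φ)

/-- On test functions, `f` is bounded by the norm of the gradient alone, as soon as some admissible
pair exists; this takes the place of a Poincaré inequality. -/
theorem exists_abs_le_of_mem_admissiblePairs {N : ℕ} {Ω : Opens (E N)} {α β c : ℝ}
    {Astar : L2Mat Ω} {Q : Set (L2Mat Ω)} {f : Hneg1 Ω} {A : L2Mat Ω} {y : H10 Ω}
    (h : (A, y) ∈ admissiblePairs Ω α β c Astar Q f) :
    ∃ k : ℝ, ∀ φ : 𝓓(Ω, ℝ), |f (testH10 φ)| ≤ k * ‖gradOf (testH10 φ)‖ := by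
  obtain ⟨k, hk⟩ := h.2.1
  refine ⟨‖flux h.1.2.1.1 (gradOf y)‖ + k, fun φ => ?_⟩
  have h1 := hk φ
  rw [sqrt_integral_gradient_sq] at h1
  rw [← eq_on_test_of_mem_admissiblePairs h φ, integral_matForm_eq_inner_flux h.1.2.1.1]
  have h2 := abs_real_inner_le_norm (gradOf (testH10 φ)) (flux h.1.2.1.1 (gradOf y))
  refine (abs_add_le _ _).trans ?_
  linarith

/-- The equation on test functions alone makes a pair admissible. -/
theorem mem_admissiblePairs_of_forall_test {N : ℕ} {Ω : Opens (E N)} {α β c : ℝ}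
    {Astar : L2Mat Ω} {Q : Set (L2Mat Ω)} {f : Hneg1 Ω} {A : L2Mat Ω} {y : H10 Ω} {k : ℝ}
    (hA : A ∈ admissibleControls Ω α β c Astar Q)
    (hf : ∀ φ : 𝓓(Ω, ℝ), |f (testH10 φ)| ≤ k * ‖gradOf (testH10 φ)‖)
    (h : ∀ φ : 𝓓(Ω, ℝ),
      (∫ x in (Ω : Set (E N)), matForm (symField A x) (gradOf (testH10 φ) x) (gradOf y x))
        + skewFormTest A y φ = f (testH10 φ)) :
    (A, y) ∈ admissiblePairs Ω α β c Astar Q f := by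
  set F := flux hA.2.1.1 (gradOf y) with hF
  have hskew : ∀ φ, skewFormTest A y φ = f (testH10 φ) - inner ℝ (gradL Ω (testH10 φ)) F := by
    intro φ
    rw [← h φ, integral_matForm_eq_inner_flux hA.2.1.1, gradL_apply]
    ring
  refine ⟨hA, ⟨k + ‖F‖, fun φ => ?_⟩, fun φ => ?_⟩
  · rw [sqrt_integral_gradient_sq, hskew, gradL_apply]
    have h1 := abs_real_inner_le_norm (gradOf (testH10 φ)) F
    have h2 := hf φ
    refine (abs_sub _ _).trans ?_
    linarith
  · have hG : Continuous fun φ : H10 Ω => f φ - inner ℝ (gradL Ω φ) F := by fun_prop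
    rw [skewForm_eq_of_forall_test hG hskew φ, integral_matForm_eq_inner_flux hA.2.1.1,
      gradL_apply]
    ring

theorem ContinuousLinearMap.tendsto_inner_of_weak {H F : Type*} [NormedAddCommGroup H]
    [InnerProductSpace ℝ H] [CompleteSpace H] [NormedAddCommGroup F] [InnerProductSpace ℝ F]
    [CompleteSpace F] (T : H →L[ℝ] F) {x : ℕ → H} {a : H}
    (hx : ∀ h : H, Tendsto (fun k => inner ℝ (x k) h) atTop (𝓝 (inner ℝ a h))) (w : F) :
    Tendsto (fun k => inner ℝ (T (x k)) w) atTop (𝓝 (inner ℝ (T a) w)) := by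
  simpa only [ContinuousLinearMap.adjoint_inner_right] using hx (ContinuousLinearMap.adjoint T w)

instance completeSpace_H10 {N : ℕ} {Ω : Opens (E N)} : CompleteSpace (H10 Ω) :=
  (Submodule.isClosed_topologicalClosure _).completeSpace_coe

instance secondCountableTopology_H10 {N : ℕ} {Ω : Opens (E N)} :
    SecondCountableTopology (H10 Ω) := by
  have : Fact ((2 : ℝ≥0∞) ≠ ∞) := ⟨by simp⟩
  have h1 : SecondCountableTopology (L2 Ω) := inferInstance
  have h2 : SecondCountableTopology (L2Vec Ω) := inferInstance
  have h3 : SecondCountableTopology (WithLp 2 (L2 Ω × L2Vec Ω)) := inferInstance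
  exact Topology.IsEmbedding.subtypeVal.secondCountableTopology

/-- Against a fixed test function, the state equation pairs the weakly convergent `∇y_k` with the
strongly convergent fields `A_kᵗ ∇φ`. -/
theorem mem_admissiblePairs_of_tendsto {N : ℕ} {Ω : Opens (E N)} {α β c : ℝ}
    {Astar : L2Mat Ω} {Q : Set (L2Mat Ω)} {f : Hneg1 Ω} {A : ℕ → L2Mat Ω} {y : ℕ → H10 Ω}
    {A₀ : L2Mat Ω} {y₀ : H10 Ω} {R : ℝ}
    (hmem : ∀ k, (A k, y k) ∈ admissiblePairs Ω α β c Astar Q f)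
    (hA₀ : A₀ ∈ admissibleControls Ω α β c Astar Q) (hA : Tendsto A atTop (𝓝 A₀))
    (hR : ∀ k, ‖y k‖ ≤ R)
    (hy : ∀ h, Tendsto (fun k => inner ℝ (y k) h) atTop (𝓝 (inner ℝ y₀ h))) :
    (A₀, y₀) ∈ admissiblePairs Ω α β c Astar Q f := by
  obtain ⟨k, hk⟩ := exists_abs_le_of_mem_admissiblePairs (hmem 0)
  refine mem_admissiblePairs_of_forall_test hA₀ hk fun φ => ?_
  have hg := (gradL Ω).tendsto_inner_of_weak hy
  have hgR : ∀ k, ‖gradL Ω (y k)‖ ≤ ‖gradL Ω‖ * R := fun k => (gradL Ω).le_opNorm_of_le (hR k)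
  have hlim : ∀ L : Mat N →L[ℝ] E N →L[ℝ] E N,
      Tendsto (fun k => inner ℝ (gradOf (y k)) (applyGradient L (A k) φ)) atTop
        (𝓝 (inner ℝ (gradOf y₀) (applyGradient L A₀ φ))) := fun L =>
    tendsto_inner_of_tendsto_inner hgR hg (((continuous_applyGradient L φ).tendsto A₀).comp hA)
  have h1 := (hlim (transposeOp (symPartₗ N))).add (hlim (transposeOp (skewPartₗ N)))
  simp only [← integral_symForm_test_eq_inner, ← skewFormTest_eq_inner] at h1
  refine tendsto_nhds_unique h1 ?_
  simp only [fun k => eq_on_test_of_mem_admissiblePairs (hmem k) φ]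
  exact tendsto_const_nhds

/-! ### The cost functional -/

theorem cost_eq {N : ℕ} {Ω : Opens (E N)} (yd : L2 Ω) {A : L2Mat Ω}
    (hA : MemLp (symField A) ∞ (leb Ω)) (y : H10 Ω) :
    cost yd (A, y) = ‖fnOf y - yd‖ ^ 2 + inner ℝ (gradOf y) (flux hA (gradOf y)) := by
  rw [← integral_matForm_eq_inner_flux]
  rfl

theorem cost_nonneg {N : ℕ} {Ω : Opens (E N)} {α β : ℝ} (hα : 0 ≤ α) (yd : L2 Ω) {A : L2Mat Ω}
    (hA : MemMαβ Ω α β (symField A)) (y : H10 Ω) : 0 ≤ cost yd (A, y) := by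
  rw [cost_eq yd hA.1]
  have h1 := mul_norm_sq_le_inner_flux hA (gradOf y)
  have h2 : 0 ≤ α * ‖gradOf y‖ ^ 2 := by positivity
  linarith [sq_nonneg ‖fnOf y - yd‖]

/-- The cost controls the full `H^1` norm of the state. -/
theorem norm_le_of_cost_le {N : ℕ} {Ω : Opens (E N)} {α β R : ℝ} (hα : 0 < α) (yd : L2 Ω)
    {A : L2Mat Ω} (hA : MemMαβ Ω α β (symField A)) {y : H10 Ω} (hR : cost yd (A, y) ≤ R) :
    ‖y‖ ≤ (Real.sqrt R + ‖yd‖) + Real.sqrt (R / α) := by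
  rw [cost_eq yd hA.1] at hR
  have h1 := mul_norm_sq_le_inner_flux hA (gradOf y)
  have h2 : 0 ≤ α * ‖gradOf y‖ ^ 2 := by positivity
  have h3 : ‖fnOf y - yd‖ ≤ Real.sqrt R := Real.le_sqrt_of_sq_le (by linarith)
  have h4 : ‖gradOf y‖ ≤ Real.sqrt (R / α) := by
    refine Real.le_sqrt_of_sq_le ((le_div_iff₀ hα).2 ?_)
    nlinarith [sq_nonneg ‖fnOf y - yd‖]
  have h5 : ‖fnOf y‖ ≤ Real.sqrt R + ‖yd‖ := by
    have := norm_le_norm_add_norm_sub' (fnOf y) yd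
    linarith
  have h6 : ‖y‖ ≤ ‖fnOf y‖ + ‖gradOf y‖ := by
    refine abs_le_of_sq_le_sq' ?_ (by positivity) |>.2
    rw [norm_sq_H10]
    nlinarith [norm_nonneg (fnOf y), norm_nonneg (gradOf y)]
  linarith

/-- Lower semicontinuity of the cost along a strongly convergent sequence of controls and a weakly
convergent sequence of states. Convexity in the state bounds the cost from below by an expression
that is affine in `y_k`, and that one passes to the limit. -/
theorem cost_le_of_tendsto {N : ℕ} {Ω : Opens (E N)} {α β : ℝ} (hα : 0 ≤ α) (hβ : 0 ≤ β)
    (yd : L2 Ω) {A : ℕ → L2Mat Ω} {y : ℕ → H10 Ω} {A₀ : L2Mat Ω} {y₀ : H10 Ω} {R m : ℝ}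
    (hM : ∀ k, MemMαβ Ω α β (symField (A k))) (hM₀ : MemMαβ Ω α β (symField A₀))
    (hA : Tendsto A atTop (𝓝 A₀)) (hR : ∀ k, ‖y k‖ ≤ R)
    (hy : ∀ h, Tendsto (fun k => inner ℝ (y k) h) atTop (𝓝 (inner ℝ y₀ h)))
    (hm : Tendsto (fun k => cost yd (A k, y k)) atTop (𝓝 m)) : cost yd (A₀, y₀) ≤ m := by
  obtain ⟨s, hs, hae⟩ := L2Mat.exists_subseq_ae_tendsto hA
  have hst := hs.tendsto_atTop
  have hsym : ∀ᵐ x ∂(leb Ω), Tendsto (fun k => symField (A (s k)) x) atTop (𝓝 (symField A₀ x)) :=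
    hae.mono fun x hx => ((continuous_symPart N).tendsto _).comp hx
  set F : ℕ → L2Vec Ω := fun k => flux (hM (s k)).1 (gradOf y₀) with hF
  have hFlim : Tendsto F atTop (𝓝 (flux hM₀.1 (gradOf y₀))) :=
    tendsto_flux _ _ (fun k => ae_norm_le_of_memMαβ (hM (s k)) hα hβ) hsym _
  have hys : ∀ h, Tendsto (fun k => inner ℝ (y (s k)) h) atTop (𝓝 (inner ℝ y₀ h)) := fun h =>
    (hy h).comp hst
  have h1 : Tendsto (fun k => inner ℝ (gradOf (y (s k))) (F k)) atTop
      (𝓝 (inner ℝ (gradOf y₀) (flux hM₀.1 (gradOf y₀)))) :=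
    tendsto_inner_of_tendsto_inner (fun k => (gradL Ω).le_opNorm_of_le (hR (s k)))
      ((gradL Ω).tendsto_inner_of_weak hys) hFlim
  have h2 : Tendsto (fun k => inner ℝ (gradOf y₀) (F k)) atTop
      (𝓝 (inner ℝ (gradOf y₀) (flux hM₀.1 (gradOf y₀)))) := tendsto_const_nhds.inner hFlim
  have h3 : Tendsto (fun k => inner ℝ (fnOf (y (s k)) - yd) (fnOf y₀ - yd)) atTop
      (𝓝 (inner ℝ (fnOf y₀ - yd) (fnOf y₀ - yd))) := by
    simp only [inner_sub_left _ yd]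
    exact ((fnL Ω).tendsto_inner_of_weak hys _).sub_const _
  have hlow := ((h3.const_mul 2).sub_const (‖fnOf y₀ - yd‖ ^ 2)).add ((h1.const_mul 2).sub h2)
  have hval : 2 * inner ℝ (fnOf y₀ - yd) (fnOf y₀ - yd) - ‖fnOf y₀ - yd‖ ^ 2
      + (2 * inner ℝ (gradOf y₀) (flux hM₀.1 (gradOf y₀))
        - inner ℝ (gradOf y₀) (flux hM₀.1 (gradOf y₀))) = cost yd (A₀, y₀) := by
    rw [cost_eq yd hM₀.1, real_inner_self_eq_norm_sq]
    ring
  rw [hval] at hlow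
  refine le_of_tendsto_of_tendsto' hlow (hm.comp hst) fun k => ?_
  change _ ≤ cost yd (A (s k), y (s k))
  rw [cost_eq yd (hM (s k)).1]
  have h4 := mul_norm_sq_le_inner_flux (hM (s k)) (gradOf (y (s k)) - gradOf y₀)
  have h5 : 0 ≤ α * ‖gradOf (y (s k)) - gradOf y₀‖ ^ 2 := by positivity
  rw [flux_sub, inner_sub_left, inner_sub_right, inner_sub_right,
    inner_flux_comm _ (hM (s k)).2.1 (gradOf y₀) (gradOf (y (s k)))] at h4
  -- `2 ⟨a, b⟩ - ‖b‖² ≤ ‖a‖²` for the first term, and the same for the form `S_k` above.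
  have h6 := norm_sub_sq_real (fnOf (y (s k)) - yd) (fnOf y₀ - yd)
  have h7 := sq_nonneg ‖(fnOf (y (s k)) - yd) - (fnOf y₀ - yd)‖
  linarith

/-! ### Existence of an optimal pair -/

theorem theorem2p14 (N : ℕ) (hN : 2 ≤ N) (Ω : TopologicalSpace.Opens (E N))
    (hΩbdd : Bornology.IsBounded (Ω : Set (E N))) (hΩconn : IsConnected (Ω : Set (E N)))
    (hΩlip : HasLipschitzBoundary (Ω : Set (E N)))
    (α β c : ℝ) (hα : 0 < α) (hαβ : α ≤ β) (hc : 0 < c)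
    (Astar : L2Mat Ω) (hAstar : IsSkewField Astar) (hAstar0 : Astar ≠ 0)
    (Q : Set (L2Mat Ω)) (hQskew : ∀ B ∈ Q, IsSkewField B)
    (hQcompact : IsCompact Q) (hQconvex : Convex ℝ Q) (hQ0 : (0 : L2Mat Ω) ∈ Q)
    (f : Hneg1 Ω) (yd : L2 Ω)
    (hreg : (admissiblePairs Ω α β c Astar Q f).Nonempty) :
    ∃ p : L2Mat Ω × H10 Ω, IsOptimalPair Ω α β c Astar Q f yd p := by
  have hβ : 0 < β := hα.trans_le hαβ
  set Ξ := admissiblePairs Ω α β c Astar Q f with hΞ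
  have hbdd : BddBelow (cost yd '' Ξ) := by
    refine ⟨0, ?_⟩
    rintro _ ⟨q, hq, rfl⟩
    exact cost_nonneg hα.le yd hq.1.2.1 q.2
  obtain ⟨v, hanti, hv, hvmem⟩ := exists_seq_tendsto_sInf (hreg.image (cost yd)) hbdd
  choose p hp hpv using hvmem
  have hcompact : IsCompact (admissibleControls Ω α β c Astar Q) :=
    isCompact_admissibleControls hΩbdd.measure_lt_top.ne hα.le hβ hc.le hQcompact
  obtain ⟨A₀, hA₀, s, hs, hA⟩ := hcompact.tendsto_subseq fun k => (hp k).1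
  have hR : ∀ k, ‖(p k).2‖ ≤ (Real.sqrt (v 0) + ‖yd‖) + Real.sqrt (v 0 / α) := fun k =>
    norm_le_of_cost_le hα yd (hp k).1.2.1 ((hpv k).trans_le (hanti k.zero_le))
  obtain ⟨y₀, t, ht, hy⟩ := exists_subseq_tendsto_inner fun k => hR (s k)
  have hAt : Tendsto (fun k => (p (s (t k))).1) atTop (𝓝 A₀) := hA.comp ht.tendsto_atTop
  have hmem : (A₀, y₀) ∈ Ξ := mem_admissiblePairs_of_tendsto (fun k => hp (s (t k))) hA₀ hAt
    (fun k => hR (s (t k))) hy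
  have hm : Tendsto (fun k => cost yd ((p (s (t k))).1, (p (s (t k))).2)) atTop
      (𝓝 (sInf (cost yd '' Ξ))) := by
    simp only [Prod.mk.eta, hpv]
    exact hv.comp (hs.comp ht).tendsto_atTop
  have hle := cost_le_of_tendsto hα.le hβ.le yd (fun k => (hp (s (t k))).1.2.1) hA₀.2.1 hAt
    (fun k => hR (s (t k))) hy hm
  exact ⟨(A₀, y₀), hmem, IsLeast.isGLB ⟨⟨_, hmem, rfl⟩, fun _ hb => hle.trans (csInf_le hbdd hb)⟩⟩
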